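/- Let $\mathbb{K}$ be a field and let $R=\bigoplus_{j\ge 0}R_j$ be a commutative $\mathbb{N}$-graded $\mathbb{K}$-algebra with $R_0=\mathbb{K}$. Let $I\subseteq R$ be a homogeneous ideal with a minimal generating set $\{f_1,\dots,f_s\}$ of homogeneous elements of degree $d$. Bigrade $S=R[T_1,\dots,T_s]$ by $\deg(x)=(0,j)$ for $x\in R_j$ and $\deg(T_k)=(1,d)$. Let $\mathcal{R}(I)=\bigoplus_{n\ge 0}I^nT^n\subseteq R[T]$ be the Rees algebra of $I$, and let $L\subseteq S$ be the kernel of the $R$-algebra homomorphism $S\to\mathcal{R}(I)$, $T_k\mapsto f_kT$. For an ideal $J\subseteq S$ write $J_{(a,b)}$ for the $\mathbb{K}$-vector space of elements of $J$ that are homogeneous of bidegree $(a,b)$ (including $0$). Let $m\ge 1$. Suppose that $L_{(1,d+1)}$ is spanned over $\mathbb{K}$ by an $S$-regular sequence $g_1,\dots,g_r$, that $L_{(m,md+1)}=(g_1,\dots,g_r)_{(m,md+1)}$, and that $L_{(m,md)}=0$. Then, for every $i\ge 0$, the graded Betti number of $I^m$ in homological degree $i$ and internal degree $md+i$, that is,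 the number of summands $R(-md-i)$ in the $i$-th free module of a minimal graded free resolution of the $R$-module $I^m$ (such a resolution exists, and this number is the same for all of them), is $$\beta_{i,md+i}(I^m)=\binom{r}{i}\binom{s+m-i-1}{m-i},$$ where the right-hand side is read as $0$ if $i>m$. -/

import Mathlib

open scoped Polynomial

universe u v w

noncomputable section

namespace ReesBetti

section Graded

variable {K : Type v} {R : Type u} [Field K] [CommRing R] [Algebra K R]

/-- The degree `j` component of the shifted module `R(-a)`: it is `R_{j-a}`, and `0` if `j < a`. -/
def shiftPiece (𝒜 : ℕ → Submodule K R) (a j : ℕ) : Submodule K R :=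
  if a ≤ j then 𝒜 (j - a) else ⊥

/-- The degree `j` component of the graded free module `⨁ b, R(-deg b)`. -/
def freePiece (𝒜 : ℕ → Submodule K R) {ι : Type*} (deg : ι → ℕ) (j : ℕ) :
    Submodule K (ι →₀ R) where
  carrier := {x | ∀ b, x b ∈ shiftPiece 𝒜 (deg b) j}
  add_mem' hx hy b := Submodule.add_mem _ (hx b) (hy b)
  zero_mem' _ := Submodule.zero_mem _
  smul_mem' c _ hx b := Submodule.smul_mem _ c (hx b)

/-- The grading on an ideal `J` of `R` induced by the grading of `R`. -/
def idealPiece (𝒜 : ℕ → Submodule K R) (J : Ideal R) (j : ℕ) : Submodule K J :=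
  (𝒜 j).comap (J.subtype.restrictScalars K)

/-- A minimal graded free resolution `⋯ → F 1 → F 0 → M → 0` of a module `M` with graded
components `ℳ j`, where `F i = ⨁ b : ι i, R(-deg i b)`. The maps preserve degrees, the sequence is
exact, and the image of every differential lies in `𝔪 F`, where `𝔪 = ⨁_{j > 0} R_j`. Ranks may be
infinite, and the resolution may have infinite length; one of finite length has `ι i` empty for
all large `i`. -/
structure MinimalGradedFreeResolution (𝒜 : ℕ → Submodule K R) [GradedAlgebra 𝒜]
    {M : Type w} [AddCommGroup M] [Module R M] [Module K M] (ℳ : ℕ → Submodule K M) where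
  ι : ℕ → Type u
  deg : ∀ i, ι i → ℕ
  d : ∀ i, (ι (i + 1) →₀ R) →ₗ[R] (ι i →₀ R)
  ε : (ι 0 →₀ R) →ₗ[R] M
  d_deg : ∀ i j, ∀ x ∈ freePiece 𝒜 (deg (i + 1)) j, d i x ∈ freePiece 𝒜 (deg i) j
  ε_deg : ∀ j, ∀ x ∈ freePiece 𝒜 (deg 0) j, ε x ∈ ℳ j
  ε_surjective : Function.Surjective ε
  exact_zero : Function.Exact (d 0) ε
  exact_succ : ∀ i, Function.Exact (d (i + 1)) (d i)
  minimal : ∀ i x, d i x ∈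
    ((HomogeneousIdeal.irrelevant 𝒜).toIdeal • ⊤ : Submodule R (ι i →₀ R))

/-- The number of summands `R(-j)` in the `i`-th free module of the resolution. -/
def MinimalGradedFreeResolution.numSummands {𝒜 : ℕ → Submodule K R} [GradedAlgebra 𝒜]
    {M : Type w} [AddCommGroup M] [Module R M] [Module K M] {ℳ : ℕ → Submodule K M}
    (F : MinimalGradedFreeResolution 𝒜 ℳ) (i j : ℕ) : ℕ∞ :=
  Set.encard {b : F.ι i | F.deg i b = j}

/-- The graded Betti number `β_{i,j}(M)` is `n`: the module `M` has a minimal graded free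
resolution, and in every such resolution `R(-j)` occurs exactly `n` times as a summand of the
`i`-th free module. -/
def HasGradedBetti (𝒜 : ℕ → Submodule K R) [GradedAlgebra 𝒜]
    {M : Type w} [AddCommGroup M] [Module R M] [Module K M] (ℳ : ℕ → Submodule K M)
    (i j n : ℕ) : Prop :=
  Nonempty (MinimalGradedFreeResolution 𝒜 ℳ) ∧
    ∀ F : MinimalGradedFreeResolution 𝒜 ℳ, F.numSummands i j = n

/-- The component of bidegree `(a, b)` of `S = R[T_1, …, T_s]`, where
`deg r = (0, deg r)` for `r ∈ R` homogeneous and `deg T_k = (1, d)`. -/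
def bidegPiece (𝒜 : ℕ → Submodule K R) (s d a b : ℕ) :
    Submodule K (MvPolynomial (Fin s) R) where
  carrier := {F | ∀ α : Fin s →₀ ℕ,
    F.coeff α ∈ (if α.degree = a then shiftPiece 𝒜 (a * d) b else ⊥ : Submodule K R)}
  add_mem' hx hy α := by
    rw [MvPolynomial.coeff_add]; exact Submodule.add_mem _ (hx α) (hy α)
  zero_mem' α := by
    rw [MvPolynomial.coeff_zero]; exact Submodule.zero_mem _
  smul_mem' c _ hx α := by
    rw [MvPolynomial.coeff_smul]; exact Submodule.smul_mem _ c (hx α)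

/-- The component `J_{(a,b)}` of an ideal `J` of `S = R[T_1, …, T_s]`. -/
def idealBidegPiece (𝒜 : ℕ → Submodule K R) {s : ℕ} (d : ℕ)
    (J : Ideal (MvPolynomial (Fin s) R)) (a b : ℕ) : Submodule K (MvPolynomial (Fin s) R) :=
  J.restrictScalars K ⊓ bidegPiece 𝒜 s d a b

end Graded

section Rees

variable {R : Type u} [CommRing R]

/-- The map `φ : R[T_1, …, T_s] → ℛ(I)`, `T_k ↦ f_k T`, for `I = (f_1, …, f_s)`. -/
def reesMap {s : ℕ} (f : Fin s → R) :
    MvPolynomial (Fin s) R →ₐ[R] reesAlgebra (Ideal.span (Set.range f)) :=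
  MvPolynomial.aeval fun k =>
    ⟨Polynomial.monomial 1 (f k), reesAlgebra.monomial_mem.2
      (by rw [pow_one]; exact Ideal.subset_span (Set.mem_range_self k))⟩

/-- The ideal `L = ker φ` of relations of the Rees algebra of `I = (f_1, …, f_s)`. -/
def reesRelations {s : ℕ} (f : Fin s → R) : Ideal (MvPolynomial (Fin s) R) :=
  RingHom.ker (reesMap f)

end Rees

end ReesBetti

end

/-! Write `J` for the ideal generated by the `g k`. Since `g` is a regular sequence, iterated
mapping cones give a Koszul-type resolution of `S / J` over `S` with `r.choose i` generators in
homological degree `i` and matrix entries of bidegree `(1, d + 1)` (`nonempty_koszulResolution`).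
Expanded in the monomials of `T`, it becomes a complex of free `R`-modules that splits according to
total `T`-degree. In the part of `T`-degree `m`, homological degree `i` has as basis the pairs of a
monomial of degree `m - i` and a Koszul generator, all of internal degree `m * d + i`, and the
entries of the differentials lie in `R_1`.

Evaluation `T_k ↦ f k` maps the degree zero term of this part onto `I ^ m`. Its kernel comes from
`L`, whereas the image of the differential comes from `J`, so the result is in general not a
resolution. The two hypotheses on `L` say precisely that they agree in internal degrees `m * d` and
`m * d + 1`, and below `m * d` there is nothing. This is a `PartialResolution`.

That much is enough for the linear strand. In a minimal complex over a module that vanishes below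
degree `n`, the generators in position `i` have degree at least `n + i`
(`PartialResolution.le_deg`), and those of degree exactly `n + i` span a subcomplex with linear
entries. Exactness in degrees `n` and `n + 1` at the start, and everywhere further on, allows the
usual comparison maps to be built between two such strands. Degree zero boundaries vanish by
minimality, so the maps are mutually inverse (`LinearComplex.nonempty_equiv`). Hence the strand of
any minimal resolution has the same ranks as the Koszul strand (`encard_strand_eq`), and counting
monomials gives the formula. Existence of a minimal resolution is separate: graded Nakayama gives
minimal covers, which are then spliced. -/

noncomputable section

namespace ReesBetti

open DirectSum

/-! ### Homogeneous components under graded maps -/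

section GradedMaps

variable {K : Type*} [Semiring K] {M N : Type*} [AddCommGroup M] [AddCommGroup N]
  [Module K M] [Module K N]

/-- Taking homogeneous components commutes with degree-preserving additive maps. -/
theorem decompose_map_of_mem (ℳ : ℕ → Submodule K M) [Decomposition ℳ]
    (𝒩 : ℕ → Submodule K N) [Decomposition 𝒩] {φ : Type*} [FunLike φ M N]
    [AddMonoidHomClass φ M N] (f : φ) (hf : ∀ j, ∀ x ∈ ℳ j, f x ∈ 𝒩 j) (x : M) (j : ℕ) :
    (decompose 𝒩 (f x) j : N) = f (decompose ℳ x j) := by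
  induction x using Decomposition.inductionOn ℳ with
  | zero => simp
  | @homogeneous i y =>
    by_cases h : i = j
    · subst h
      rw [decompose_of_mem_same _ (hf _ _ y.2), decompose_of_mem_same _ y.2]
    · rw [decompose_of_mem_ne _ (hf _ _ y.2) h, decompose_of_mem_ne _ y.2 h, map_zero]
  | add y z hy hz => simp [decompose_add, hy, hz]

end GradedMaps

/-! ### Gradings induced on homogeneous submodules -/

section Submodules

variable {K : Type*} {R : Type*} [Field K] [CommRing R] [Algebra K R] {M : Type*}
  [AddCommGroup M] [Module R M] [Module K M] [IsScalarTower K R M]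

/-- The grading on a submodule induced by a grading of the ambient module. -/
def submodulePiece (ℳ : ℕ → Submodule K M) (N : Submodule R M) (j : ℕ) : Submodule K N :=
  (ℳ j).comap (N.subtype.restrictScalars K)

/-- A homogeneous submodule is graded by its intersections with the graded components. -/
theorem submodulePiece_isInternal (ℳ : ℕ → Submodule K M) [Decomposition ℳ] (N : Submodule R M)
    (hN : ∀ x ∈ N, ∀ j, (decompose ℳ x j : M) ∈ N) : IsInternal (submodulePiece ℳ N) := by
  classical
  -- The ambient projection to degree `j` recovers the `j`-th summand, so a sum determines its
  -- summands; this gives injectivity.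
  have key : ∀ (y : ⨁ j, submodulePiece ℳ N j) (j : ℕ),
      (decompose ℳ ((DirectSum.coeAddMonoidHom (submodulePiece ℳ N) y : N) : M) j : M) =
        ((y j : N) : M) := by
    intro y j
    induction y using DirectSum.induction_on with
    | zero => simp
    | of k z =>
      rw [DirectSum.coeAddMonoidHom_of]
      have hz : ((z : N) : M) ∈ ℳ k := z.2
      by_cases h : k = j
      · subst h
        rw [decompose_of_mem_same _ hz, DirectSum.of_eq_same]
      · rw [decompose_of_mem_ne _ hz h, DirectSum.of_eq_of_ne _ _ _ (Ne.symm h)]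
        simp
    | add y z hy hz => simp [decompose_add, hy, hz]
  constructor
  · rw [injective_iff_map_eq_zero]
    intro y hy
    ext j
    have := key y j
    rw [hy] at this
    simpa using this.symm
  · intro x
    refine ⟨∑ j ∈ (decompose ℳ (x : M)).support,
      DirectSum.of (fun j => submodulePiece ℳ N j) j
        ⟨⟨decompose ℳ (x : M) j, hN x x.2 j⟩, (decompose ℳ (x : M) j).2⟩, ?_⟩
    rw [map_sum]
    simp only [DirectSum.coeAddMonoidHom_of]
    apply Subtype.ext
    rw [AddSubmonoidClass.coe_finsetSum]
    exact sum_support_decompose ℳ (x : M)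

end Submodules

/-! ### Graded free modules with shifted generators -/

section FreePieces

variable {K : Type*} {R : Type*} [Field K] [CommRing R] [Algebra K R] {𝒜 : ℕ → Submodule K R}

theorem mem_shiftPiece_of_le {a j : ℕ} (h : a ≤ j) {x : R} :
    x ∈ shiftPiece 𝒜 a j ↔ x ∈ 𝒜 (j - a) := by
  rw [shiftPiece, if_pos h]

theorem mem_shiftPiece_add {a k : ℕ} {x : R} : x ∈ shiftPiece 𝒜 a (a + k) ↔ x ∈ 𝒜 k := by
  rw [mem_shiftPiece_of_le (Nat.le_add_right _ _), Nat.add_sub_cancel_left]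

theorem mem_shiftPiece_self {a : ℕ} {x : R} : x ∈ shiftPiece 𝒜 a a ↔ x ∈ 𝒜 0 := by
  rw [mem_shiftPiece_of_le le_rfl, Nat.sub_self]

theorem mem_shiftPiece_of_lt {a j : ℕ} (h : j < a) {x : R} :
    x ∈ shiftPiece 𝒜 a j ↔ x = 0 := by
  rw [shiftPiece, if_neg (not_le.2 h), Submodule.mem_bot]

theorem single_mem_freePiece {ι : Type*} {deg : ι → ℕ} {j : ℕ} {b : ι} {a : R}
    (h : a ∈ shiftPiece 𝒜 (deg b) j) : Finsupp.single b a ∈ freePiece 𝒜 deg j := by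
  classical
  intro c
  by_cases hc : b = c
  · subst hc; simpa using h
  · rw [Finsupp.single_eq_of_ne (Ne.symm hc)]; exact Submodule.zero_mem _

/-- The component of `single b a` in the grading of a graded free module, for `a` of degree `k`. -/
def singlePiece (𝒜 : ℕ → Submodule K R) {ι : Type*} (deg : ι → ℕ) (b : ι) (k : ℕ) :
    𝒜 k →ₗ[K] freePiece 𝒜 deg (deg b + k) :=
  (Finsupp.lsingle b ∘ₗ (𝒜 k).subtype).codRestrict _ fun a =>
    single_mem_freePiece (mem_shiftPiece_add.2 a.2)

variable (𝒜) [GradedAlgebra 𝒜]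

theorem one_mem_zero : (1 : R) ∈ 𝒜 0 := SetLike.GradedOne.one_mem

theorem single_one_mem_freePiece {ι : Type*} {deg : ι → ℕ} (b : ι) :
    Finsupp.single b (1 : R) ∈ freePiece 𝒜 deg (deg b) :=
  single_mem_freePiece (mem_shiftPiece_self.2 (one_mem_zero 𝒜))

/-- The decomposition of a graded free module into its homogeneous components. -/
def freeDecompose {ι : Type*} (deg : ι → ℕ) : (ι →₀ R) →ₗ[K] ⨁ j, freePiece 𝒜 deg j :=
  Finsupp.lsum K fun b =>
    (DirectSum.toModule K ℕ (⨁ j, freePiece 𝒜 deg j) fun k =>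
      DirectSum.lof K ℕ (fun j => freePiece 𝒜 deg j) (deg b + k) ∘ₗ singlePiece 𝒜 deg b k) ∘ₗ
    (decomposeLinearEquiv 𝒜).toLinearMap

theorem freeDecompose_single {ι : Type*} (deg : ι → ℕ) (b : ι) {k : ℕ} {a : R} (ha : a ∈ 𝒜 k) :
    freeDecompose 𝒜 deg (Finsupp.single b a) =
      DirectSum.lof K ℕ (fun j => freePiece 𝒜 deg j) (deg b + k)
        (singlePiece 𝒜 deg b k ⟨a, ha⟩) := by
  simp only [freeDecompose, Finsupp.lsum_single, LinearMap.comp_apply, LinearEquiv.coe_coe,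
    decomposeLinearEquiv_apply, decompose_of_mem 𝒜 ha]
  exact DirectSum.toModule_lof K k _

theorem freeDecompose_of_mem {ι : Type*} (deg : ι → ℕ) {j : ℕ} (x : freePiece 𝒜 deg j) :
    freeDecompose 𝒜 deg (x : ι →₀ R) =
      DirectSum.lof K ℕ (fun j => freePiece 𝒜 deg j) j x := by
  classical
  have h : ∀ b, freeDecompose 𝒜 deg (Finsupp.single b ((x : ι →₀ R) b)) =
      DirectSum.lof K ℕ (fun j => freePiece 𝒜 deg j) j
        ⟨Finsupp.single b ((x : ι →₀ R) b), single_mem_freePiece (x.2 b)⟩ := by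
    intro b
    have hb := x.2 b
    by_cases hle : deg b ≤ j
    · obtain ⟨k, rfl⟩ := Nat.exists_eq_add_of_le hle
      rw [freeDecompose_single 𝒜 deg b (mem_shiftPiece_add.1 hb)]
      rfl
    · rw [mem_shiftPiece_of_lt (not_le.1 hle)] at hb
      have : (⟨Finsupp.single b ((x : ι →₀ R) b), single_mem_freePiece (x.2 b)⟩ :
          freePiece 𝒜 deg j) = 0 := Subtype.ext (by simp [hb])
      rw [this, hb]
      simp
  have hx : x = ∑ b ∈ (x : ι →₀ R).support,
      (⟨Finsupp.single b ((x : ι →₀ R) b), single_mem_freePiece (x.2 b)⟩ : freePiece 𝒜 deg j) := by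
    apply Subtype.ext
    rw [AddSubmonoidClass.coe_finsetSum]
    exact (Finsupp.sum_single (x : ι →₀ R)).symm
  conv_rhs => rw [hx]
  conv_lhs => rw [← Finsupp.sum_single (x : ι →₀ R), Finsupp.sum]
  rw [map_sum, map_sum]
  exact Finset.sum_congr rfl fun b _ => h b

instance freePieceDecomposition {ι : Type*} (deg : ι → ℕ) :
    Decomposition (freePiece 𝒜 deg) :=
  Decomposition.ofLinearMap _ (freeDecompose 𝒜 deg)
    (by
      refine Finsupp.lhom_ext' fun b => decompose_lhom_ext 𝒜 fun k => ?_
      ext1 a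
      simp only [LinearMap.comp_apply, Finsupp.lsingle_apply, Submodule.subtype_apply,
        freeDecompose_single 𝒜 deg b a.2, DirectSum.coeLinearMap_lof, LinearMap.id_apply]
      rfl)
    (by
      refine DirectSum.linearMap_ext _ fun j => ?_
      ext1 x
      simp only [LinearMap.comp_apply, DirectSum.coeLinearMap_lof, LinearMap.id_apply]
      exact freeDecompose_of_mem 𝒜 deg x)

theorem smul_mem_freePiece {ι : Type*} {deg : ι → ℕ} {p q : ℕ} {a : R} {x : ι →₀ R}
    (ha : a ∈ 𝒜 p) (hx : x ∈ freePiece 𝒜 deg q) : a • x ∈ freePiece 𝒜 deg (p + q) := by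
  intro b
  have hb := hx b
  rw [Finsupp.smul_apply, smul_eq_mul]
  by_cases h : deg b ≤ q
  · rw [mem_shiftPiece_of_le h] at hb
    rw [mem_shiftPiece_of_le (h.trans (Nat.le_add_left _ _)), Nat.add_sub_assoc h]
    exact SetLike.GradedMul.mul_mem ha hb
  · rw [mem_shiftPiece_of_lt (not_le.1 h)] at hb
    rw [hb, mul_zero]
    exact Submodule.zero_mem _

/-- This is how minimality is always used: a matrix entry that degree reasons force to be a scalar
must vanish. -/
theorem eq_zero_of_mem_irrelevant {a : R} (h₀ : a ∈ 𝒜 0)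
    (h : a ∈ (HomogeneousIdeal.irrelevant 𝒜).toIdeal) : a = 0 := by
  have h' := (HomogeneousIdeal.mem_irrelevant_iff 𝒜 a).1 h
  rwa [GradedRing.proj_apply, decompose_of_mem_same 𝒜 h₀] at h'

theorem mem_smul_top_finsupp_iff {ι : Type*} (J : Ideal R) (x : ι →₀ R) :
    x ∈ (J • ⊤ : Submodule R (ι →₀ R)) ↔ ∀ b, x b ∈ J := by
  constructor
  · intro hx b
    induction hx using Submodule.smul_induction_on' with
    | smul a ha y _ => exact J.mul_mem_right _ ha
    | add y _ z _ hy hz => exact J.add_mem hy hz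
  · intro hx
    rw [← Finsupp.sum_single x]
    refine Submodule.sum_mem _ fun b _ => ?_
    have : Finsupp.single b (x b) = x b • Finsupp.single b (1 : R) := by simp
    rw [this]
    exact Submodule.smul_mem_smul (hx b) trivial

end FreePieces

/-! ### Minimal covers by graded Nakayama -/

section Cover

variable {K : Type v} {R : Type u} [Field K] [CommRing R] [Algebra K R]
  (𝒜 : ℕ → Submodule K R) {M : Type u} [AddCommGroup M] [Module R M] [Module K M]
  (ℳ : ℕ → Submodule K M)

/-- The degree `j` component of `𝔪 M`, where `𝔪 = ⨁_{p > 0} R_p`. -/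
def irrelevantPiece (j : ℕ) : Submodule K M :=
  Submodule.span K {y | ∃ p q : ℕ, 0 < p ∧ p + q = j ∧ ∃ a ∈ 𝒜 p, ∃ n ∈ ℳ q, a • n = y}

/-- The degree `j` component of `M / 𝔪 M`. -/
abbrev fiberPiece (j : ℕ) : Type u :=
  ℳ j ⧸ (irrelevantPiece 𝒜 ℳ j).comap (ℳ j).subtype

/-- A graded module over a connected graded algebra is covered by a graded free module whose basis
lifts a basis of the fiber `M / 𝔪 M`; the kernel of the cover lies in `𝔪 F`. -/
theorem exists_minimal_cover [IsScalarTower K R M] [GradedAlgebra 𝒜]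
    (h𝒜 : Function.Surjective (algebraMap K (𝒜 0))) [Decomposition ℳ]
    (hsmul : ∀ p q, ∀ a ∈ 𝒜 p, ∀ n ∈ ℳ q, a • n ∈ ℳ (p + q)) :
    ∃ (ι : Type u) (deg : ι → ℕ) (ε : (ι →₀ R) →ₗ[R] M),
      (∀ j, ∀ x ∈ freePiece 𝒜 deg j, ε x ∈ ℳ j) ∧ Function.Surjective ε ∧
      ∀ x, ε x = 0 → ∀ b, x b ∈ (HomogeneousIdeal.irrelevant 𝒜).toIdeal := by
  classical
  have hscalar : ∀ a ∈ 𝒜 0, ∃ c : K, algebraMap K R c = a := fun a ha => by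
    obtain ⟨c, hc⟩ := h𝒜 ⟨a, ha⟩
    exact ⟨c, congrArg Subtype.val hc⟩
  let B := fun j => Module.Basis.ofVectorSpace K (fiberPiece 𝒜 ℳ j)
  let ι : Type u := Σ j, Module.Basis.ofVectorSpaceIndex K (fiberPiece 𝒜 ℳ j)
  let deg : ι → ℕ := Sigma.fst
  have hz : ∀ b : ι, ∃ z : ℳ b.1, Submodule.mkQ _ z = B b.1 b.2 := fun b =>
    Submodule.mkQ_surjective _ _
  choose z hz using hz
  let ε : (ι →₀ R) →ₗ[R] M := Finsupp.linearCombination R fun b => (z b : M)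
  have hterm : ∀ j, ∀ x ∈ freePiece 𝒜 deg j, ∀ b, x b • (z b : M) ∈ ℳ j := by
    intro j x hx b
    have hb := hx b
    by_cases h : deg b ≤ j
    · rw [mem_shiftPiece_of_le h] at hb
      have := hsmul _ _ _ hb _ (z b).2
      rwa [Nat.sub_add_cancel h] at this
    · rw [mem_shiftPiece_of_lt (not_le.1 h)] at hb
      rw [hb, zero_smul]
      exact Submodule.zero_mem _
  have hε : ∀ j, ∀ x ∈ freePiece 𝒜 deg j, ε x ∈ ℳ j := fun j x hx =>
    Submodule.sum_mem _ fun b _ => hterm j x hx b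
  have hε_single : ∀ b : ι, ε (Finsupp.single b 1) = z b := fun b => by
    simp [ε, Finsupp.linearCombination_single]
  refine ⟨ι, deg, ε, hε, ?_, ?_⟩
  -- Graded Nakayama by strong induction on the degree: the part from `𝔪 M` involves only lower
  -- degrees, and the rest is spanned by the chosen lifts.
  · have hrange : ∀ j, ℳ j ≤ (LinearMap.range ε).restrictScalars K := by
      intro j
      induction j using Nat.strong_induction_on with
      | _ j ih =>
      have hD : irrelevantPiece 𝒜 ℳ j ≤ (LinearMap.range ε).restrictScalars K := by
        refine Submodule.span_le.2 ?_
        rintro y ⟨p, q, hp, hpq, a, -, n, hn, rfl⟩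
        exact Submodule.smul_mem (LinearMap.range ε) a (ih q (by omega) hn)
      have hW : (⊤ : Submodule K (fiberPiece 𝒜 ℳ j)) ≤
          (((LinearMap.range ε).restrictScalars K).comap (ℳ j).subtype).map
            (Submodule.mkQ _) := by
        rw [← (B j).span_eq, Submodule.span_le]
        rintro _ ⟨b, rfl⟩
        exact ⟨z ⟨j, b⟩, ⟨_, hε_single ⟨j, b⟩⟩, hz ⟨j, b⟩⟩
      intro x hx
      obtain ⟨w, hw, hwx⟩ := hW (x := Submodule.mkQ _ ⟨x, hx⟩) trivial
      have hsub := (Submodule.Quotient.eq _).1 hwx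
      have h1 : (w : M) - x ∈ (LinearMap.range ε).restrictScalars K := hD hsub
      have h2 := Submodule.sub_mem _ (show (w : M) ∈ _ from hw) h1
      simpa using h2
    intro x
    have : x ∈ LinearMap.range ε := by
      rw [← sum_support_decompose ℳ x]
      exact Submodule.sum_mem _ fun j _ => hrange j (decompose ℳ x j).2
    exact this
  -- A relation in degree `deg b` has a scalar coefficient at `b`. The functional `ℓ` dual to `b` on
  -- the fiber extracts it: generators of lower degree contribute elements of `𝔪 M`, those of higher
  -- degree have coefficient zero, and the remaining ones are independent in the fiber.
  · have key : ∀ (b : ι) (y : ι →₀ R), y ∈ freePiece 𝒜 deg (deg b) → ε y = 0 → y b = 0 := by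
      rintro ⟨j, b⟩ y hy hεy
      let ℓ : ℳ j →ₗ[K] K := (B j).coord b ∘ₗ Submodule.mkQ _
      obtain ⟨c, hc⟩ := hscalar _ (mem_shiftPiece_self.1 (hy ⟨j, b⟩))
      have hterm_eq : ∀ (b' : Module.Basis.ofVectorSpaceIndex K (fiberPiece 𝒜 ℳ j)) (c' : K),
          algebraMap K R c' = y ⟨j, b'⟩ →
          ℓ ⟨y ⟨j, b'⟩ • (z ⟨j, b'⟩ : M), hterm j y hy ⟨j, b'⟩⟩ = if b' = b then c' else 0 := by
        intro b' c' hc'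
        have : (⟨y ⟨j, b'⟩ • (z ⟨j, b'⟩ : M), hterm j y hy ⟨j, b'⟩⟩ : ℳ j) = c' • z ⟨j, b'⟩ := by
          apply Subtype.ext
          simp only [Submodule.coe_smul, ← hc', algebraMap_smul]
        rw [this, map_smul, LinearMap.comp_apply, hz ⟨j, b'⟩, Module.Basis.coord_apply,
          Module.Basis.repr_self, Finsupp.single_apply]
        simp
      have hsum : ∑ b' ∈ y.support, (⟨y b' • (z b' : M), hterm j y hy b'⟩ : ℳ j) = 0 := by
        apply Subtype.ext
        rw [AddSubmonoidClass.coe_finsetSum]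
        exact hεy
      have hℓ := congrArg ℓ hsum
      rw [map_sum, map_zero, Finset.sum_eq_single (⟨j, b⟩ : ι)] at hℓ
      · rw [hterm_eq b c hc, if_pos rfl] at hℓ
        rw [← hc, hℓ, map_zero]
      · rintro ⟨j', b'⟩ - hne
        rcases lt_trichotomy j' j with hlt | rfl | hgt
        · have hD : (⟨y ⟨j', b'⟩ • (z ⟨j', b'⟩ : M), hterm j y hy ⟨j', b'⟩⟩ : ℳ j) ∈
              (irrelevantPiece 𝒜 ℳ j).comap (ℳ j).subtype := by
            refine Submodule.subset_span ⟨j - j', j', by omega, by omega, y ⟨j', b'⟩, ?_,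
              z ⟨j', b'⟩, (z ⟨j', b'⟩).2, rfl⟩
            exact (mem_shiftPiece_of_le hlt.le).1 (hy ⟨j', b'⟩)
          rw [LinearMap.comp_apply, Submodule.mkQ_apply, (Submodule.Quotient.mk_eq_zero _).2 hD,
            map_zero]
        · obtain ⟨c', hc'⟩ := hscalar _ (mem_shiftPiece_self.1 (hy ⟨j', b'⟩))
          rw [hterm_eq b' c' hc', if_neg]
          rintro rfl
          exact hne rfl
        · have h0 := (mem_shiftPiece_of_lt hgt).1 (hy ⟨j', b'⟩)
          convert map_zero ℓ using 2
          apply Subtype.ext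
          simp [h0]
      · intro hb
        convert map_zero ℓ using 2
        apply Subtype.ext
        simp [Finsupp.notMem_support_iff.1 hb]
    intro x hx b
    have hcomp : ∀ k, ε (decompose (freePiece 𝒜 deg) x k) = 0 := fun k => by
      rw [← decompose_map_of_mem _ ℳ ε hε, hx]
      simp
    rw [← sum_support_decompose (freePiece 𝒜 deg) x, Finsupp.finsetSum_apply]
    refine Ideal.sum_mem _ fun k _ => ?_
    have hk := (decompose (freePiece 𝒜 deg) x k).2
    -- The coordinate at `b` of a component of degree `k` has degree `k - deg b`; only a positive
    -- difference can leave a nonzero coordinate.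
    rcases lt_trichotomy k (deg b) with hlt | rfl | hgt
    · rw [(mem_shiftPiece_of_lt hlt).1 (hk b)]
      exact Ideal.zero_mem _
    · rw [key b _ hk (hcomp _)]
      exact Ideal.zero_mem _
    · exact HomogeneousIdeal.mem_irrelevant_of_mem 𝒜 (Nat.sub_pos_of_lt hgt)
        ((mem_shiftPiece_of_le hgt.le).1 (hk b))

end Cover

/-! ### Existence of minimal graded free resolutions -/

section Resolution

/-- A graded module over a graded algebra, in bundled form. -/
structure BundledGradedModule {K : Type v} {R : Type u} [Field K] [CommRing R] [Algebra K R]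
    (𝒜 : ℕ → Submodule K R) where
  carrier : Type u
  [addCommGroup : AddCommGroup carrier]
  [module : Module R carrier]
  [moduleBase : Module K carrier]
  [tower : IsScalarTower K R carrier]
  piece : ℕ → Submodule K carrier
  [decomposition : Decomposition piece]
  smul_mem : ∀ p q, ∀ a ∈ 𝒜 p, ∀ n ∈ piece q, a • n ∈ piece (p + q)

attribute [instance] BundledGradedModule.addCommGroup BundledGradedModule.module
  BundledGradedModule.moduleBase BundledGradedModule.tower BundledGradedModule.decomposition

variable {K : Type v} {R : Type u} [Field K] [CommRing R] [Algebra K R]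
  {𝒜 : ℕ → Submodule K R} [GradedAlgebra 𝒜]

/-- A graded free cover of a graded module with kernel contained in `𝔪 F`. -/
structure MinimalCover (X : BundledGradedModule 𝒜) where
  ι : Type u
  deg : ι → ℕ
  ε : (ι →₀ R) →ₗ[R] X.carrier
  ε_deg : ∀ j, ∀ x ∈ freePiece 𝒜 deg j, ε x ∈ X.piece j
  ε_surjective : Function.Surjective ε
  minimal : ∀ x, ε x = 0 → ∀ b, x b ∈ (HomogeneousIdeal.irrelevant 𝒜).toIdeal

/-- The kernel of a minimal cover, as a graded module. -/
def MinimalCover.syzygy {X : BundledGradedModule 𝒜} (C : MinimalCover X) :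
    BundledGradedModule 𝒜 :=
  letI : Decomposition (submodulePiece (freePiece 𝒜 C.deg) (LinearMap.ker C.ε)) :=
    (submodulePiece_isInternal _ _ fun x hx j => by
      rw [LinearMap.mem_ker] at hx ⊢
      rw [← decompose_map_of_mem _ X.piece C.ε C.ε_deg, hx]
      simp).chooseDecomposition
  { carrier := LinearMap.ker C.ε
    piece := submodulePiece (freePiece 𝒜 C.deg) (LinearMap.ker C.ε)
    smul_mem := fun _ _ _ ha _ hn => smul_mem_freePiece 𝒜 ha hn }

theorem nonempty_minimalCover (h𝒜 : Function.Surjective (algebraMap K (𝒜 0)))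
    (X : BundledGradedModule 𝒜) : Nonempty (MinimalCover X) := by
  obtain ⟨ι, deg, ε, h1, h2, h3⟩ := exists_minimal_cover 𝒜 X.piece h𝒜 X.smul_mem
  exact ⟨⟨ι, deg, ε, h1, h2, h3⟩⟩

/-- The differential obtained by splicing a cover of a module with a cover of its syzygy. -/
def MinimalCover.splice {X : BundledGradedModule 𝒜} (C : MinimalCover X)
    (D : MinimalCover C.syzygy) : (D.ι →₀ R) →ₗ[R] (C.ι →₀ R) :=
  (LinearMap.ker C.ε).subtype ∘ₗ D.ε

theorem MinimalCover.splice_eq_zero_iff {X : BundledGradedModule 𝒜} (C : MinimalCover X)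
    (D : MinimalCover C.syzygy) (x : D.ι →₀ R) : C.splice D x = 0 ↔ D.ε x = 0 :=
  Submodule.coe_eq_zero (p := LinearMap.ker C.ε)

theorem MinimalCover.exact_splice {X : BundledGradedModule 𝒜} (C : MinimalCover X)
    (D : MinimalCover C.syzygy) : Function.Exact (C.splice D) C.ε := by
  intro y
  constructor
  · intro hy
    obtain ⟨x, hx⟩ := D.ε_surjective (⟨y, hy⟩ : LinearMap.ker C.ε)
    exact ⟨x, congrArg Subtype.val hx⟩
  · rintro ⟨x, rfl⟩
    exact (D.ε x : LinearMap.ker C.ε).2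

/-- The iterated syzygies of a graded module with respect to a choice of covers. -/
def iteratedSyzygy (C : ∀ Y : BundledGradedModule 𝒜, MinimalCover Y)
    (X : BundledGradedModule 𝒜) : ℕ → BundledGradedModule 𝒜
  | 0 => X
  | n + 1 => (C (iteratedSyzygy C X n)).syzygy

/-- Every graded module over a connected graded algebra has a minimal graded free resolution. -/
theorem nonempty_minimalGradedFreeResolution
    (h𝒜 : Function.Surjective (algebraMap K (𝒜 0))) (X : BundledGradedModule 𝒜) :
    Nonempty (MinimalGradedFreeResolution 𝒜 X.piece) := by
  let C : ∀ Y : BundledGradedModule 𝒜, MinimalCover Y := fun Y => (nonempty_minimalCover h𝒜 Y).some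
  let Y := iteratedSyzygy C X
  have hex : ∀ i, Function.Exact ((C (Y i)).splice (C (Y (i + 1)))) (C (Y i)).ε := fun i =>
    (C (Y i)).exact_splice _
  exact ⟨{
    ι := fun i => (C (Y i)).ι
    deg := fun i => (C (Y i)).deg
    d := fun i => (C (Y i)).splice (C (Y (i + 1)))
    ε := (C X).ε
    d_deg := fun i j x hx => (C (Y (i + 1))).ε_deg j x hx
    ε_deg := (C X).ε_deg
    ε_surjective := (C X).ε_surjective
    exact_zero := hex 0
    -- The inclusion of the syzygy is injective, so the spliced differential has the same kernel as
    -- the next cover.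
    exact_succ := fun i y => ((C (Y i)).splice_eq_zero_iff _ y).trans (hex (i + 1) y)
    minimal := fun i x => (mem_smul_top_finsupp_iff _ _).2
      ((C (Y i)).minimal _ ((hex i _).2 ⟨x, rfl⟩)) }⟩

end Resolution

/-! ### Linear complexes and their uniqueness -/

theorem map_eq_sum_single {R : Type*} [CommRing R] {ι κ : Type*}
    (φ : (ι →₀ R) →ₗ[R] (κ →₀ R)) (x : ι →₀ R) :
    φ x = ∑ b ∈ x.support, x b • φ (Finsupp.single b 1) := by
  conv_lhs => rw [← Finsupp.sum_single x, Finsupp.sum, map_sum]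
  refine Finset.sum_congr rfl fun b _ => ?_
  rw [← map_smul, Finsupp.smul_single_one]

section LinearComplex

variable {K : Type*} {R : Type*} [Field K] [CommRing R] [Algebra K R]

/-- A linear map between free modules whose matrix has entries of degree `k` sends vectors with
coordinates of degree `l` to vectors with coordinates of degree `l + k`. -/
theorem map_coord_mem (𝒜 : ℕ → Submodule K R) [GradedAlgebra 𝒜] {ι κ : Type*}
    (φ : (ι →₀ R) →ₗ[R] (κ →₀ R)) {k l : ℕ}
    (hφ : ∀ b c, φ (Finsupp.single b 1) c ∈ 𝒜 k) {x : ι →₀ R} (hx : ∀ b, x b ∈ 𝒜 l) (c : κ) :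
    φ x c ∈ 𝒜 (l + k) := by
  classical
  rw [map_eq_sum_single φ x, Finsupp.finsetSum_apply]
  exact Submodule.sum_mem _ fun b _ => SetLike.GradedMul.mul_mem (hx b) (hφ b c)

/-- A complex of free modules with linear differentials, augmented to a module `M`, that is exact
in the degrees that determine it: the augmentation maps the span of the basis over the degree
zero scalars bijectively to `N ⊆ M`, and a cycle with coordinates of degree one is the
differential of a unique chain with coordinates of degree zero. -/
structure LinearComplex (𝒜 : ℕ → Submodule K R) {M : Type*} [AddCommGroup M] [Module R M]
    (N : Set M) where
  ι : ℕ → Type w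
  d : ∀ i, (ι (i + 1) →₀ R) →ₗ[R] (ι i →₀ R)
  ε : (ι 0 →₀ R) →ₗ[R] M
  d_single_mem : ∀ i b c, d i (Finsupp.single b 1) c ∈ 𝒜 1
  ε_single_mem : ∀ b, ε (Finsupp.single b 1) ∈ N
  ε_d : ∀ x, ε (d 0 x) = 0
  d_d : ∀ i x, d i (d (i + 1) x) = 0
  exists_of_mem : ∀ u ∈ N, ∃ x : ι 0 →₀ R, (∀ b, x b ∈ 𝒜 0) ∧ ε x = u
  ε_injective : ∀ x : ι 0 →₀ R, (∀ b, x b ∈ 𝒜 0) → ε x = 0 → x = 0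
  d_injective : ∀ i, ∀ x : ι (i + 1) →₀ R, (∀ b, x b ∈ 𝒜 0) → d i x = 0 → x = 0
  exact_zero : ∀ x : ι 0 →₀ R, (∀ b, x b ∈ 𝒜 1) → ε x = 0 →
    ∃ y : ι 1 →₀ R, (∀ b, y b ∈ 𝒜 0) ∧ d 0 y = x
  exact_succ : ∀ i, ∀ x : ι (i + 1) →₀ R, (∀ b, x b ∈ 𝒜 1) → d i x = 0 →
    ∃ y : ι (i + 2) →₀ R, (∀ b, y b ∈ 𝒜 0) ∧ d (i + 1) y = x

namespace LinearComplex

variable {𝒜 : ℕ → Submodule K R} {M : Type*} [AddCommGroup M] [Module R M] {N : Set M}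

/-- A morphism of linear complexes over the identity of `M`, of degree zero. -/
structure Hom (P : LinearComplex 𝒜 N) (Q : LinearComplex 𝒜 N) where
  φ : ∀ i, (P.ι i →₀ R) →ₗ[R] (Q.ι i →₀ R)
  single_mem : ∀ i b c, φ i (Finsupp.single b 1) c ∈ 𝒜 0
  ε_comm : ∀ x, Q.ε (φ 0 x) = P.ε x
  d_comm : ∀ i x, Q.d i (φ (i + 1) x) = φ i (P.d i x)

theorem exists_lift {P Q : Type*} {T : Type*} [AddCommGroup T] [Module R T]
    (α : (P →₀ R) →ₗ[R] T) (β : (Q →₀ R) →ₗ[R] T)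
    (h : ∀ b, ∃ y : Q →₀ R, (∀ c, y c ∈ 𝒜 0) ∧ β y = α (Finsupp.single b 1)) :
    ∃ φ : (P →₀ R) →ₗ[R] (Q →₀ R), (∀ b c, φ (Finsupp.single b 1) c ∈ 𝒜 0) ∧
      ∀ x, β (φ x) = α x := by
  choose y hy hβ using h
  refine ⟨Finsupp.linearCombination R y, fun b c => ?_, fun x => ?_⟩
  · rw [Finsupp.linearCombination_single, one_smul]
    exact hy b c
  · have : β ∘ₗ Finsupp.linearCombination R y = α := by
      ext b
      simp [hβ]
    exact LinearMap.congr_fun this x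

variable [GradedAlgebra 𝒜]

/-- The comparison theorem for projective resolutions, one basis vector at a time. A scalar matrix
applied to a linear one has linear entries, so each lifting problem concerns a cycle with
coordinates of degree one, where `Q` is exact. -/
theorem nonempty_hom (P : LinearComplex 𝒜 N) (Q : LinearComplex 𝒜 N) : Nonempty (Hom P Q) := by
  -- The invariant of the recursion includes solvability of the next lifting problem, so each step
  -- needs only the previous map.
  let Good : ∀ i, ((P.ι i →₀ R) →ₗ[R] (Q.ι i →₀ R)) → Prop := fun i φ =>
    (∀ b c, φ (Finsupp.single b 1) c ∈ 𝒜 0) ∧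
    ∀ b, ∃ y : Q.ι (i + 1) →₀ R, (∀ c, y c ∈ 𝒜 0) ∧ Q.d i y = φ (P.d i (Finsupp.single b 1))
  obtain ⟨φ₀, h₀, hε⟩ := exists_lift (𝒜 := 𝒜) P.ε Q.ε fun b =>
    Q.exists_of_mem _ (P.ε_single_mem b)
  have good₀ : Good 0 φ₀ := by
    refine ⟨h₀, fun b => Q.exact_zero _ (fun c => ?_) ?_⟩
    · simpa using map_coord_mem 𝒜 φ₀ h₀ (P.d_single_mem 0 b) c
    · rw [hε, P.ε_d]
  have step : ∀ i (φ : {φ // Good i φ}), ∃ ψ : {ψ // Good (i + 1) ψ},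
      ∀ x, Q.d i (ψ.1 x) = φ.1 (P.d i x) := by
    rintro i ⟨φ, h, hφ⟩
    obtain ⟨ψ, hψ, hcomm⟩ := exists_lift (𝒜 := 𝒜) (φ ∘ₗ P.d i) (Q.d i) hφ
    refine ⟨⟨ψ, hψ, fun b => Q.exact_succ i _ (fun c => ?_) ?_⟩, hcomm⟩
    · simpa using map_coord_mem 𝒜 ψ hψ (P.d_single_mem (i + 1) b) c
    · rw [hcomm, LinearMap.comp_apply, P.d_d, map_zero]
  choose next hnext using step
  let Φ : ∀ i, {φ // Good i φ} := fun i => Nat.rec ⟨φ₀, good₀⟩ next i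
  exact ⟨⟨fun i => (Φ i).1, fun i => (Φ i).2.1, hε, fun i => hnext i (Φ i)⟩⟩

/-- Morphisms of linear complexes over the identity of `M` compose to the identity. -/
theorem Hom.comp_eq_self {P : LinearComplex 𝒜 N} {Q : LinearComplex 𝒜 N} (f : Hom P Q) (g : Hom Q P) (i : ℕ)
    (x : P.ι i →₀ R) : g.φ i (f.φ i x) = x := by
  classical
  -- No homotopy is needed: the difference from the identity has scalar coordinates, and on such
  -- vectors the augmentation and the differentials are injective.
  have hmem : ∀ i b c, (g.φ i (f.φ i (Finsupp.single b 1)) - Finsupp.single b 1 : P.ι i →₀ R) c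
      ∈ 𝒜 0 := by
    intro i b c
    rw [Finsupp.sub_apply]
    refine Submodule.sub_mem _ ?_ ?_
    · simpa using map_coord_mem 𝒜 (g.φ i) (g.single_mem i) (f.single_mem i b) c
    · rw [Finsupp.single_apply]
      split_ifs
      exacts [one_mem_zero 𝒜, Submodule.zero_mem _]
  have hext : ∀ i, (∀ b, g.φ i (f.φ i (Finsupp.single b 1)) = Finsupp.single b 1) →
      ∀ x, g.φ i (f.φ i x) = x := by
    intro i h x
    have : g.φ i ∘ₗ f.φ i = LinearMap.id := by
      refine Finsupp.lhom_ext' fun b => LinearMap.ext_ring ?_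
      simpa using h b
    exact LinearMap.congr_fun this x
  induction i with
  | zero =>
    refine hext 0 (fun b => sub_eq_zero.1 (P.ε_injective _ (hmem 0 b) ?_)) x
    rw [map_sub, g.ε_comm, f.ε_comm, sub_self]
  | succ i ih =>
    refine hext (i + 1) (fun b => sub_eq_zero.1 (P.d_injective i _ (hmem (i + 1) b) ?_)) x
    rw [map_sub, g.d_comm, f.d_comm, ih, sub_self]

/-- A linear complex is determined up to isomorphism by its augmentation. -/
theorem nonempty_equiv [Nontrivial R] (P : LinearComplex 𝒜 N) (Q : LinearComplex 𝒜 N) (i : ℕ) :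
    Nonempty (P.ι i ≃ Q.ι i) := by
  obtain ⟨f⟩ := nonempty_hom P Q
  obtain ⟨g⟩ := nonempty_hom Q P
  let e : (P.ι i →₀ R) ≃ₗ[R] (Q.ι i →₀ R) :=
    LinearEquiv.ofLinearMap (f.φ i) (g.φ i) (LinearMap.ext (g.comp_eq_self f i))
      (LinearMap.ext (f.comp_eq_self g i))
  exact ⟨(Finsupp.basisSingleOne.map e).indexEquiv Finsupp.basisSingleOne⟩

end LinearComplex

end LinearComplex

/-! ### The linear strand of a partial resolution -/

section LinearStrand

variable {K : Type*} {R : Type*} [Field K] [CommRing R] [Algebra K R]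

/-- A minimal complex of graded free modules that is exact in positive homological degrees and
augmented to a graded module `M`, the augmentation being surjective and exact in the internal
degrees `n` and `n + 1`. -/
structure PartialResolution (𝒜 : ℕ → Submodule K R) [GradedAlgebra 𝒜]
    {M : Type*} [AddCommGroup M] [Module R M] [Module K M] (ℳ : ℕ → Submodule K M) (n : ℕ) where
  ι : ℕ → Type w
  deg : ∀ i, ι i → ℕ
  d : ∀ i, (ι (i + 1) →₀ R) →ₗ[R] (ι i →₀ R)
  ε : (ι 0 →₀ R) →ₗ[R] M
  d_deg : ∀ i j, ∀ x ∈ freePiece 𝒜 (deg (i + 1)) j, d i x ∈ freePiece 𝒜 (deg i) j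
  ε_deg : ∀ j, ∀ x ∈ freePiece 𝒜 (deg 0) j, ε x ∈ ℳ j
  ε_surjective : Function.Surjective ε
  ε_d : ∀ x, ε (d 0 x) = 0
  exact_zero : ∀ j, j ≤ n + 1 → ∀ x ∈ freePiece 𝒜 (deg 0) j, ε x = 0 → ∃ y, d 0 y = x
  exact_succ : ∀ i, Function.Exact (d (i + 1)) (d i)
  minimal : ∀ i x b, d i x b ∈ (HomogeneousIdeal.irrelevant 𝒜).toIdeal

/-- A minimal graded free resolution, as a partial resolution. -/
def MinimalGradedFreeResolution.toPartialResolution {K : Type v} {R : Type u} [Field K]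
    [CommRing R] [Algebra K R] {𝒜 : ℕ → Submodule K R} [GradedAlgebra 𝒜]
    {M : Type w} [AddCommGroup M] [Module R M] [Module K M] {ℳ : ℕ → Submodule K M}
    (F : MinimalGradedFreeResolution 𝒜 ℳ) (n : ℕ) : PartialResolution 𝒜 ℳ n where
  ι := F.ι
  deg := F.deg
  d := F.d
  ε := F.ε
  d_deg := F.d_deg
  ε_deg := F.ε_deg
  ε_surjective := F.ε_surjective
  ε_d x := (F.exact_zero _).2 ⟨x, rfl⟩
  exact_zero _ _ x _ hx := (F.exact_zero x).1 hx
  exact_succ := F.exact_succ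
  minimal i x := (mem_smul_top_finsupp_iff _ _).1 (F.minimal i x)

section Restriction

variable {ι : Type*} (s : Set ι)

/-- Extension by zero of vectors indexed by a subset of the basis. -/
def extendZero (R : Type*) [CommRing R] {ι : Type*} (s : Set ι) : (s →₀ R) →ₗ[R] (ι →₀ R) :=
  Finsupp.lmapDomain R R Subtype.val

/-- Restriction of vectors to a subset of the basis. -/
def restrictTo (R : Type*) [CommRing R] {ι : Type*} (s : Set ι) : (ι →₀ R) →ₗ[R] (s →₀ R) :=
  Finsupp.lsubtypeDomain s

@[simp] theorem restrictTo_apply (x : ι →₀ R) (b : s) : restrictTo R s x b = x b := rfl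

@[simp] theorem extendZero_single (b : s) (a : R) :
    extendZero R s (Finsupp.single b a) = Finsupp.single (b : ι) a :=
  Finsupp.mapDomain_single

theorem extendZero_apply (x : s →₀ R) (b : s) : extendZero R s x b = x b :=
  Finsupp.mapDomain_apply Subtype.val_injective x b

theorem extendZero_apply_of_notMem (x : s →₀ R) {b : ι} (hb : b ∉ s) : extendZero R s x b = 0 :=
  Finsupp.mapDomain_of_notMem_range x b (by simpa using hb)

theorem restrictTo_extendZero (x : s →₀ R) : restrictTo R s (extendZero R s x) = x :=
  Finsupp.ext fun b => extendZero_apply s x b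

theorem extendZero_injective : Function.Injective (extendZero R s) :=
  Function.LeftInverse.injective (restrictTo_extendZero s)

theorem extendZero_restrictTo {x : ι →₀ R} (hx : ∀ b ∉ s, x b = 0) :
    extendZero R s (restrictTo R s x) = x := by
  ext b
  by_cases hb : b ∈ s
  · exact extendZero_apply s _ ⟨b, hb⟩
  · rw [extendZero_apply_of_notMem s _ hb, hx b hb]

end Restriction

namespace PartialResolution

variable {𝒜 : ℕ → Submodule K R} [GradedAlgebra 𝒜] {M : Type*} [AddCommGroup M] [Module R M]
  [Module K M] {ℳ : ℕ → Submodule K M} {n : ℕ} (P : PartialResolution 𝒜 ℳ n)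

theorem d_d (i : ℕ) (x) : P.d i (P.d (i + 1) x) = 0 :=
  (P.exact_succ i _).2 ⟨x, rfl⟩

theorem one_notMem_irrelevant [Nontrivial R] :
    (1 : R) ∉ (HomogeneousIdeal.irrelevant 𝒜).toIdeal := fun h =>
  one_ne_zero (eq_zero_of_mem_irrelevant 𝒜 (one_mem_zero 𝒜) h)

theorem single_notMem_range [Nontrivial R] {i : ℕ} (b : P.ι i) (y) :
    P.d i y ≠ Finsupp.single b 1 := fun h => by
  have := P.minimal i y b
  rw [h, Finsupp.single_eq_same] at this
  exact one_notMem_irrelevant this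

/-- The generators in homological degree `i` have internal degree at least `n + i`. -/
theorem le_deg [Nontrivial R] (hM : ∀ j < n, ℳ j = ⊥) (i : ℕ) (b : P.ι i) :
    n + i ≤ P.deg i b := by
  induction i with
  | zero =>
    -- A generator of degree below `n` would map to zero in `M`, hence be a boundary, contrary to
    -- minimality.
    by_contra hlt
    have h1 := P.ε_deg _ _ (single_one_mem_freePiece 𝒜 (deg := P.deg 0) b)
    rw [hM _ (by omega), Submodule.mem_bot] at h1
    obtain ⟨y, hy⟩ := P.exact_zero _ (by omega) _ (single_one_mem_freePiece 𝒜 b) h1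
    exact P.single_notMem_range b y hy
  | succ i ih =>
    by_contra hlt
    have h1 := P.d_deg i _ _ (single_one_mem_freePiece 𝒜 (deg := P.deg (i + 1)) b)
    -- By induction all target generators have degree at least `n + i ≥ deg b`. So each coordinate
    -- is zero for degree reasons, or is a scalar in `𝔪` and again zero; then `single b 1` is a
    -- cycle, hence a boundary.
    have h0 : P.d i (Finsupp.single b 1) = 0 := by
      ext c
      have hc := h1 c
      rcases lt_or_eq_of_le (show P.deg (i + 1) b ≤ P.deg i c from
        le_trans (by omega) (ih c)) with h | h
      · exact (mem_shiftPiece_of_lt h).1 hc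
      · rw [h] at hc
        exact eq_zero_of_mem_irrelevant 𝒜 (mem_shiftPiece_self.1 hc) (P.minimal i _ c)
    obtain ⟨y, hy⟩ := (P.exact_succ i _).1 h0
    exact P.single_notMem_range b y hy

/-- The generators of lowest possible internal degree. -/
def strand (i : ℕ) : Set (P.ι i) := {b | P.deg i b = n + i}

theorem apply_mem_of_mem_strand {i k : ℕ} {x : P.ι i →₀ R}
    (hx : x ∈ freePiece 𝒜 (P.deg i) (n + i + k)) (b : P.strand i) : x b ∈ 𝒜 k := by
  have h := hx b
  rw [show P.deg i b = n + i from b.2] at h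
  exact mem_shiftPiece_add.1 h

theorem extendZero_mem_freePiece {i k : ℕ} {x : P.strand i →₀ R} (hx : ∀ b, x b ∈ 𝒜 k) :
    extendZero R (P.strand i) x ∈ freePiece 𝒜 (P.deg i) (n + i + k) := by
  intro b
  by_cases hb : b ∈ P.strand i
  · rw [show P.deg i b = n + i from hb, mem_shiftPiece_add]
    exact extendZero_apply (P.strand i) x ⟨b, hb⟩ ▸ hx ⟨b, hb⟩
  · rw [extendZero_apply_of_notMem _ _ hb]
    exact Submodule.zero_mem _

/-- By `le_deg`, only strand generators can carry coefficients in the lowest degree `n + i`. -/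
theorem extendZero_restrictTo_of_mem [Nontrivial R] (hM : ∀ j < n, ℳ j = ⊥) {i : ℕ}
    {x : P.ι i →₀ R} (hx : x ∈ freePiece 𝒜 (P.deg i) (n + i)) :
    extendZero R (P.strand i) (restrictTo R (P.strand i) x) = x :=
  extendZero_restrictTo _ fun b hb => (mem_shiftPiece_of_lt
    (lt_of_le_of_ne (P.le_deg hM i b) (Ne.symm hb))).1 (hx b)

theorem exists_homogeneous_lift {i j : ℕ} {x : P.ι i →₀ R} (hx : x ∈ freePiece 𝒜 (P.deg i) j)
    (h : ∃ y, P.d i y = x) : ∃ y ∈ freePiece 𝒜 (P.deg (i + 1)) j, P.d i y = x := by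
  obtain ⟨y, rfl⟩ := h
  refine ⟨decompose (freePiece 𝒜 (P.deg (i + 1))) y j, SetLike.coe_mem _, ?_⟩
  rw [← decompose_map_of_mem _ (freePiece 𝒜 (P.deg i)) (P.d i) (P.d_deg i),
    decompose_of_mem_same _ hx]

/-- The differential of the linear strand. -/
def strandD (i : ℕ) : (P.strand (i + 1) →₀ R) →ₗ[R] (P.strand i →₀ R) :=
  restrictTo R (P.strand i) ∘ₗ P.d i ∘ₗ extendZero R (P.strand (i + 1))

/-- The strand is a subcomplex: a component off the strand would sit on a generator of degree at
least `n + i + 1`, so it is zero or a scalar, and minimality excludes nonzero scalars. -/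
theorem extendZero_strandD [Nontrivial R] (hM : ∀ j < n, ℳ j = ⊥) (i : ℕ)
    (x : P.strand (i + 1) →₀ R) :
    extendZero R (P.strand i) (P.strandD i x) = P.d i (extendZero R (P.strand (i + 1)) x) := by
  suffices extendZero R (P.strand i) ∘ₗ P.strandD i = P.d i ∘ₗ extendZero R (P.strand (i + 1)) from
    LinearMap.congr_fun this x
  refine Finsupp.lhom_ext' fun b => LinearMap.ext_ring ?_
  simp only [LinearMap.comp_apply, Finsupp.lsingle_apply, strandD, extendZero_single]
  refine extendZero_restrictTo _ fun c hc => ?_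
  have h1 := P.d_deg i _ _ (single_one_mem_freePiece 𝒜 (deg := P.deg (i + 1)) b) c
  rw [show P.deg (i + 1) b = n + (i + 1) from b.2] at h1
  have h2 : n + i < P.deg i c := lt_of_le_of_ne (P.le_deg hM i c) (Ne.symm hc)
  rcases lt_or_eq_of_le (show n + (i + 1) ≤ P.deg i c by omega) with h | h
  · exact (mem_shiftPiece_of_lt h).1 h1
  · rw [h] at h1
    exact eq_zero_of_mem_irrelevant 𝒜 (mem_shiftPiece_self.1 h1) (P.minimal i _ c)

/-- A homogeneous preimage has degree `n + i + 1`, the lowest possible in position `i + 1`, so it is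
automatically supported on the strand with scalar coordinates. -/
theorem exists_strand_lift [Nontrivial R] (hM : ∀ j < n, ℳ j = ⊥) {i : ℕ} {x : P.strand i →₀ R}
    (hx : ∀ b, x b ∈ 𝒜 1) (h : ∃ y, P.d i y = extendZero R (P.strand i) x) :
    ∃ y : P.strand (i + 1) →₀ R, (∀ b, y b ∈ 𝒜 0) ∧ P.strandD i y = x := by
  obtain ⟨y, hy, hyx⟩ := P.exists_homogeneous_lift (P.extendZero_mem_freePiece hx) h
  refine ⟨restrictTo R _ y, fun b => P.apply_mem_of_mem_strand (k := 0) hy b,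
    extendZero_injective _ ?_⟩
  rw [P.extendZero_strandD hM, P.extendZero_restrictTo_of_mem hM hy, hyx]

theorem eq_zero_of_exists [Nontrivial R] {i : ℕ} {x : P.strand i →₀ R} (hx : ∀ b, x b ∈ 𝒜 0)
    (h : ∃ y, P.d i y = extendZero R (P.strand i) x) : x = 0 := by
  obtain ⟨y, hy⟩ := h
  ext b
  refine eq_zero_of_mem_irrelevant 𝒜 (hx b) ?_
  rw [← extendZero_apply (P.strand i) x b, ← hy]
  exact P.minimal i y b

/-- The linear strand of a partial resolution of a module generated in degrees at least `n`. -/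
def linearStrand [Nontrivial R] [Decomposition ℳ] (hM : ∀ j < n, ℳ j = ⊥) :
    LinearComplex 𝒜 (ℳ n : Set M) where
  ι i := P.strand i
  d := P.strandD
  ε := P.ε ∘ₗ extendZero R (P.strand 0)
  d_single_mem i b c := by
    have h := P.d_deg i _ _ (single_one_mem_freePiece 𝒜 (deg := P.deg (i + 1)) b)
    rw [show P.deg (i + 1) b = n + i + 1 from b.2] at h
    simpa [strandD] using P.apply_mem_of_mem_strand h c
  ε_single_mem b := by
    have h := P.ε_deg _ _ (single_one_mem_freePiece 𝒜 (deg := P.deg 0) b)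
    rw [show P.deg 0 b = n from b.2] at h
    simpa using h
  ε_d x := by
    rw [LinearMap.comp_apply, P.extendZero_strandD hM, P.ε_d]
  d_d i x := extendZero_injective _ (by
    rw [P.extendZero_strandD hM, P.extendZero_strandD hM, P.d_d, map_zero])
  exists_of_mem u hu := by
    obtain ⟨x, rfl⟩ := P.ε_surjective u
    have hx := (decompose (freePiece 𝒜 (P.deg 0)) x n).2
    refine ⟨restrictTo R _ (decompose (freePiece 𝒜 (P.deg 0)) x n : P.ι 0 →₀ R),
      fun b => P.apply_mem_of_mem_strand (k := 0) hx b, ?_⟩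
    rw [LinearMap.comp_apply, P.extendZero_restrictTo_of_mem hM hx,
      ← decompose_map_of_mem _ ℳ P.ε P.ε_deg, decompose_of_mem_same _ hu]
  ε_injective x hx h := P.eq_zero_of_exists hx
    (P.exact_zero n (Nat.le_succ n) _ (P.extendZero_mem_freePiece hx) h)
  d_injective i x hx h := P.eq_zero_of_exists hx ((P.exact_succ i _).1 (by
    rw [← P.extendZero_strandD hM, h, map_zero]))
  exact_zero x hx h := P.exists_strand_lift hM hx
    (P.exact_zero (n + 1) le_rfl _ (P.extendZero_mem_freePiece hx) h)
  exact_succ i x hx h := P.exists_strand_lift hM hx ((P.exact_succ i _).1 (by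
    rw [← P.extendZero_strandD hM, h, map_zero]))

/-- The linear strands of two partial resolutions of the same module have the same ranks. -/
theorem encard_strand_eq [Nontrivial R] [Decomposition ℳ] (hM : ∀ j < n, ℳ j = ⊥)
    (Q : PartialResolution 𝒜 ℳ n) (i : ℕ) : (P.strand i).encard = (Q.strand i).encard := by
  obtain ⟨e⟩ := LinearComplex.nonempty_equiv (P.linearStrand hM) (Q.linearStrand hM) i
  exact Set.encard_congr e

end PartialResolution

end LinearStrand

/-! ### Koszul resolutions by iterated mapping cones -/

section Koszul

variable {S : Type*} [CommRing S]

/-- A free resolution of `S / J` whose `i`-th term has rank `n.choose i` and whose differentials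
have matrix entries in `H`. -/
structure KoszulResolution (H : AddSubgroup S) (J : Ideal S) (n : ℕ) where
  ι : ℕ → Type
  finite : ∀ i, Finite (ι i)
  card : ∀ i, Nat.card (ι i) = n.choose i
  base : ι 0
  eq_base : ∀ b, b = base
  d : ∀ i, (ι (i + 1) →₀ S) →ₗ[S] (ι i →₀ S)
  d_single_mem : ∀ i b c, d i (Finsupp.single b 1) c ∈ H
  mem_range_iff : ∀ x, (∃ y, d 0 y = x) ↔ x base ∈ J
  exact : ∀ i, Function.Exact (d (i + 1)) (d i)

namespace KoszulResolution

variable {H : AddSubgroup S} {J : Ideal S} {n : ℕ}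

/-- The resolution of `S` by itself. -/
def trivial (H : AddSubgroup S) : KoszulResolution H ⊥ 0 where
  ι
    | 0 => Unit
    | _ + 1 => Empty
  finite
    | 0 => inferInstanceAs (Finite Unit)
    | _ + 1 => inferInstanceAs (Finite Empty)
  card
    | 0 => by simp
    | _ + 1 => by simp
  base := ()
  eq_base _ := rfl
  d _ := 0
  d_single_mem _ _ _ := H.zero_mem
  mem_range_iff x := by
    constructor
    · rintro ⟨y, rfl⟩
      simp
    · intro h
      refine ⟨0, ?_⟩
      exact Finsupp.ext fun b => (show x () = 0 from h).symm
  exact i x := by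
    have : x = 0 := Finsupp.ext fun b : Empty => b.elim
    subst this
    simp

section Cone

variable {α β γ δ : Type} (g : S)

/-- The vectors on a disjoint union as pairs of vectors. -/
abbrev sumEquiv (S : Type*) [CommRing S] (α β : Type) :
    (α ⊕ β →₀ S) ≃ₗ[S] (α →₀ S) × (β →₀ S) :=
  Finsupp.sumFinsuppLEquivProdFinsupp S

theorem single_inl_eq (b : α) : Finsupp.single (Sum.inl b) (1 : S) =
    (sumEquiv S α β).symm (Finsupp.single b 1, 0) := by
  classical
  rw [LinearEquiv.eq_symm_apply]
  ext c <;> simp [Finsupp.single_apply]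

theorem single_inr_eq (b : β) : Finsupp.single (Sum.inr b) (1 : S) =
    (sumEquiv S α β).symm (0, Finsupp.single b 1) := by
  classical
  rw [LinearEquiv.eq_symm_apply]
  ext c <;> simp [Finsupp.single_apply]

/-- The differential from degree one to degree zero of the mapping cone of multiplication
by `g`. -/
def coneHead (d : (α →₀ S) →ₗ[S] (β →₀ S)) : (α ⊕ β →₀ S) →ₗ[S] (β →₀ S) :=
  d.coprod (g • LinearMap.id) ∘ₗ (sumEquiv S α β).toLinearMap

/-- The differentials in higher degrees of the mapping cone of multiplication by `g`. -/
def coneTail (d₂ : (α →₀ S) →ₗ[S] (β →₀ S)) (d₁ : (β →₀ S) →ₗ[S] (γ →₀ S)) :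
    (α ⊕ β →₀ S) →ₗ[S] (β ⊕ γ →₀ S) :=
  (sumEquiv S β γ).symm.toLinearMap ∘ₗ
    (d₂.coprod (g • LinearMap.id)).prod (-d₁ ∘ₗ LinearMap.snd S _ _) ∘ₗ
    (sumEquiv S α β).toLinearMap

theorem coneHead_symm (d : (α →₀ S) →ₗ[S] (β →₀ S)) (x y) :
    coneHead g d ((sumEquiv S α β).symm (x, y)) = d x + g • y := by
  simp only [coneHead, LinearMap.comp_apply, LinearEquiv.coe_coe, LinearEquiv.apply_symm_apply]
  rfl

theorem coneTail_symm (d₂ : (α →₀ S) →ₗ[S] (β →₀ S)) (d₁ : (β →₀ S) →ₗ[S] (γ →₀ S)) (x y) :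
    coneTail g d₂ d₁ ((sumEquiv S α β).symm (x, y)) =
      (sumEquiv S β γ).symm (d₂ x + g • y, -d₁ y) := by
  simp only [coneTail, LinearMap.comp_apply, LinearEquiv.coe_coe, LinearEquiv.apply_symm_apply]
  rfl

/-- Away from the augmentation the cone is exact for every `g`, since both copies of the complex are
exact there. -/
theorem exact_coneTail {d₃ : (α →₀ S) →ₗ[S] (β →₀ S)} {d₂ : (β →₀ S) →ₗ[S] (γ →₀ S)}
    {d₁ : (γ →₀ S) →ₗ[S] (δ →₀ S)} (h₃₂ : Function.Exact d₃ d₂) (h₂₁ : Function.Exact d₂ d₁) :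
    Function.Exact (coneTail g d₃ d₂) (coneTail g d₂ d₁) := by
  intro z
  obtain ⟨⟨x, y⟩, rfl⟩ := (sumEquiv S _ _).symm.surjective z
  constructor
  · intro h
    rw [coneTail_symm, LinearEquiv.map_eq_zero_iff, Prod.mk_eq_zero, neg_eq_zero] at h
    obtain ⟨w, rfl⟩ := (h₂₁ y).1 h.2
    obtain ⟨v, hv⟩ := (h₃₂ (x + g • w)).1 (by rw [map_add, map_smul, h.1])
    refine ⟨(sumEquiv S _ _).symm (v, -w), ?_⟩
    rw [coneTail_symm, hv, map_neg, neg_neg, smul_neg, add_neg_cancel_right]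
  · rintro ⟨w, hw⟩
    obtain ⟨⟨v, w⟩, rfl⟩ := (sumEquiv S _ _).symm.surjective w
    rw [← hw, coneTail_symm, coneTail_symm, map_neg, h₂₁.apply_apply_eq_zero, map_add,
      h₃₂.apply_apply_eq_zero, map_smul, smul_neg, zero_add, add_neg_cancel, neg_zero, neg_zero,
      ← Prod.zero_eq_mk, map_zero]

/-- Here regularity enters: `hg` says that `g` is a non-zero-divisor on the cokernel of `d₁`. -/
theorem exact_coneHead {d₂ : (α →₀ S) →ₗ[S] (β →₀ S)} {d₁ : (β →₀ S) →ₗ[S] (γ →₀ S)}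
    (h₂₁ : Function.Exact d₂ d₁) (hg : ∀ y, (∃ x, d₁ x = g • y) → ∃ x, d₁ x = y) :
    Function.Exact (coneTail g d₂ d₁) (coneHead g d₁) := by
  intro z
  obtain ⟨⟨x, y⟩, rfl⟩ := (sumEquiv S _ _).symm.surjective z
  constructor
  · intro h
    rw [coneHead_symm] at h
    obtain ⟨w, rfl⟩ := hg y ⟨-x, by rw [map_neg]; exact (eq_neg_of_add_eq_zero_right h).symm⟩
    obtain ⟨v, hv⟩ := (h₂₁ (x + g • w)).1 (by rw [map_add, map_smul, h])
    refine ⟨(sumEquiv S _ _).symm (v, -w), ?_⟩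
    rw [coneTail_symm, hv, map_neg, neg_neg, smul_neg, add_neg_cancel_right]
  · rintro ⟨w, hw⟩
    obtain ⟨⟨v, w⟩, rfl⟩ := (sumEquiv S _ _).symm.surjective w
    rw [← hw, coneTail_symm, coneHead_symm, map_add, h₂₁.apply_apply_eq_zero, map_smul, smul_neg,
      zero_add, add_neg_cancel]

theorem smul_single_mem {g : S} (hg : g ∈ H) (b c : α) :
    (g • Finsupp.single b (1 : S)) c ∈ H := by
  classical
  rw [Finsupp.smul_single, smul_eq_mul, mul_one, Finsupp.single_apply]
  split_ifs
  exacts [hg, H.zero_mem]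

theorem coneHead_single_mem {g : S} (hg : g ∈ H) {d : (α →₀ S) →ₗ[S] (β →₀ S)}
    (hd : ∀ b c, d (Finsupp.single b 1) c ∈ H) (b c) :
    coneHead g d (Finsupp.single b 1) c ∈ H := by
  rcases b with b | b
  · rw [single_inl_eq, coneHead_symm, smul_zero, add_zero]
    exact hd b c
  · rw [single_inr_eq, coneHead_symm, map_zero, zero_add]
    exact smul_single_mem hg b c

theorem coneTail_single_mem {g : S} (hg : g ∈ H) {d₂ : (α →₀ S) →ₗ[S] (β →₀ S)}
    {d₁ : (β →₀ S) →ₗ[S] (γ →₀ S)} (hd₂ : ∀ b c, d₂ (Finsupp.single b 1) c ∈ H)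
    (hd₁ : ∀ b c, d₁ (Finsupp.single b 1) c ∈ H) (b c) :
    coneTail g d₂ d₁ (Finsupp.single b 1) c ∈ H := by
  rcases b with b | b
  · rw [single_inl_eq, coneTail_symm]
    rcases c with c | c
    · simpa using hd₂ b c
    · simp [H.zero_mem]
  · rw [single_inr_eq, coneTail_symm]
    rcases c with c | c
    · simpa using smul_single_mem hg b c
    · simpa using hd₁ b c

end Cone

/-- The basis of the mapping cone. -/
def coneIndex (ι : ℕ → Type) : ℕ → Type
  | 0 => ι 0
  | i + 1 => ι (i + 1) ⊕ ι i

/-- The mapping cone of multiplication by a non-zero-divisor modulo `J`. -/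
def cone (C : KoszulResolution H J n) {g : S} (hgH : g ∈ H) (hg : ∀ a, g * a ∈ J → a ∈ J) :
    KoszulResolution H (J ⊔ Ideal.span {g}) (n + 1) where
  ι := coneIndex C.ι
  finite
    | 0 => C.finite 0
    | i + 1 => by
      have := C.finite i
      have := C.finite (i + 1)
      exact inferInstanceAs (Finite (C.ι (i + 1) ⊕ C.ι i))
  card
    | 0 => (C.card 0).trans (by simp)
    | i + 1 => by
      have := C.finite i
      have := C.finite (i + 1)
      refine (Nat.card_sum (α := C.ι (i + 1)) (β := C.ι i)).trans ?_
      -- Pascal's rule matches the two summands of the cone.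
      rw [C.card, C.card, Nat.choose_succ_succ, add_comm]
  base := C.base
  eq_base := C.eq_base
  d
    | 0 => coneHead g (C.d 0)
    | i + 1 => coneTail g (C.d (i + 1)) (C.d i)
  d_single_mem
    | 0 => coneHead_single_mem hgH (C.d_single_mem 0)
    | i + 1 => coneTail_single_mem hgH (C.d_single_mem (i + 1)) (C.d_single_mem i)
  mem_range_iff := by
    intro (x : C.ι 0 →₀ S)
    change (∃ y, coneHead g (C.d 0) y = x) ↔ x C.base ∈ _
    rw [Submodule.mem_sup]
    constructor
    · rintro ⟨z, rfl⟩
      obtain ⟨⟨v, w⟩, rfl⟩ := (sumEquiv S _ _).symm.surjective z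
      refine ⟨_, (C.mem_range_iff _).1 ⟨v, rfl⟩, g * w C.base,
        Ideal.mul_mem_right _ _ (Ideal.mem_span_singleton_self g), ?_⟩
      rw [coneHead_symm]
      simp
    · rintro ⟨a, ha, b, hb, hab⟩
      obtain ⟨c, rfl⟩ := Ideal.mem_span_singleton'.1 hb
      obtain ⟨v, hv⟩ := (C.mem_range_iff (Finsupp.single C.base a)).2 (by simpa using ha)
      refine ⟨(sumEquiv S _ _).symm (v, Finsupp.single C.base c), ?_⟩
      rw [coneHead_symm, hv]
      ext b
      rw [C.eq_base b, ← hab]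
      simp [mul_comm]
  exact
    | 0 => exact_coneHead g (C.exact 0) fun y hy => (C.mem_range_iff y).2 (hg _ (by
        simpa using (C.mem_range_iff _).1 hy))
    | i + 1 => exact_coneTail g (C.exact (i + 1)) (C.exact i)

end KoszulResolution

/-- The quotient by a weakly regular sequence has a resolution of Koszul type. -/
theorem nonempty_koszulResolution (H : AddSubgroup S) (gs : List S) (hH : ∀ g ∈ gs, g ∈ H)
    (hreg : RingTheory.Sequence.IsWeaklyRegular S gs) :
    Nonempty (KoszulResolution H (Ideal.ofList gs) gs.length) := by
  induction gs using List.reverseRecOn with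
  | nil =>
    rw [Ideal.ofList_nil]
    exact ⟨KoszulResolution.trivial H⟩
  | append_singleton gs g ih =>
    rw [RingTheory.Sequence.isWeaklyRegular_append_iff,
      RingTheory.Sequence.isWeaklyRegular_singleton_iff] at hreg
    obtain ⟨C⟩ := ih (fun a ha => hH a (by simp [ha])) hreg.1
    rw [Ideal.ofList_append, Ideal.ofList_singleton, List.length_append, List.length_singleton]
    refine ⟨C.cone (hH g (by simp)) fun a ha => ?_⟩
    have h := hreg.2
    rw [smul_eq_mul, Ideal.mul_top] at h
    have := @h (Submodule.Quotient.mk a) 0 (by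
      simp only [smul_zero]
      rw [← Submodule.Quotient.mk_smul, Submodule.Quotient.mk_eq_zero]
      exact ha)
    exact (Submodule.Quotient.mk_eq_zero _).1 this

end Koszul

/-! ### Block diagonal maps and direct summands of complexes -/

section Block

variable {R : Type*} [CommRing R] {ι κ ν : Type*}

/-- The block of a linear map of free modules on subsets of the bases. -/
def block (s : Set ι) (t : Set κ) (D : (ι →₀ R) →ₗ[R] (κ →₀ R)) : (s →₀ R) →ₗ[R] (t →₀ R) :=
  restrictTo R t ∘ₗ D ∘ₗ extendZero R s

/-- The matrix of `D` is block diagonal with respect to `s`, `t` and their complements. -/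
def IsBlockDiagonal (s : Set ι) (t : Set κ) (D : (ι →₀ R) →ₗ[R] (κ →₀ R)) : Prop :=
  ∀ b c, D (Finsupp.single b 1) c ≠ 0 → (b ∈ s ↔ c ∈ t)

variable {s : Set ι} {t : Set κ} {D : (ι →₀ R) →ₗ[R] (κ →₀ R)}

theorem IsBlockDiagonal.extendZero_block (h : IsBlockDiagonal s t D) (x : s →₀ R) :
    extendZero R t (block s t D x) = D (extendZero R s x) := by
  suffices extendZero R t ∘ₗ block s t D = D ∘ₗ extendZero R s from LinearMap.congr_fun this x
  refine Finsupp.lhom_ext' fun b => LinearMap.ext_ring ?_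
  simp only [LinearMap.comp_apply, Finsupp.lsingle_apply, block, extendZero_single]
  refine extendZero_restrictTo _ fun c hc => ?_
  by_contra hne
  exact hc ((h _ _ hne).1 b.2)

theorem IsBlockDiagonal.restrictTo_map (h : IsBlockDiagonal s t D) (x : ι →₀ R) :
    restrictTo R t (D x) = block s t D (restrictTo R s x) := by
  suffices restrictTo R t ∘ₗ D = block s t D ∘ₗ restrictTo R s from LinearMap.congr_fun this x
  refine Finsupp.lhom_ext' fun b => LinearMap.ext_ring ?_
  simp only [LinearMap.comp_apply, Finsupp.lsingle_apply, block]
  by_cases hb : b ∈ s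
  · rw [extendZero_restrictTo]
    intro c hc
    exact Finsupp.single_eq_of_ne fun hbc => hc (hbc ▸ hb)
  · have h0 : restrictTo R s (Finsupp.single b (1 : R)) = 0 := by
      ext c
      exact Finsupp.single_eq_of_ne fun hbc => hb (hbc ▸ c.2)
    rw [h0, map_zero, map_zero, map_zero]
    ext c
    by_contra hne
    exact hb ((h b c hne).2 c.2)

theorem IsBlockDiagonal.exact {r : Set ν} {D' : (κ →₀ R) →ₗ[R] (ν →₀ R)}
    (h : IsBlockDiagonal s t D) (h' : IsBlockDiagonal t r D') (hex : Function.Exact D D') :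
    Function.Exact (block s t D) (block t r D') := by
  intro x
  constructor
  · intro hx
    obtain ⟨y, hy⟩ := (hex (extendZero R t x)).1 (by rw [← h'.extendZero_block, hx, map_zero])
    exact ⟨restrictTo R s y, by rw [← h.restrictTo_map, hy, restrictTo_extendZero]⟩
  · rintro ⟨y, rfl⟩
    refine extendZero_injective _ ?_
    rw [h'.extendZero_block, h.extendZero_block, hex.apply_apply_eq_zero, map_zero]

end Block

/-! ### Matrices with linear entries -/

section LinearMatrices

variable {K : Type*} {R : Type*} [Field K] [CommRing R] [Algebra K R] {𝒜 : ℕ → Submodule K R}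
  {ι κ : Type*} {φ : (ι →₀ R) →ₗ[R] (κ →₀ R)}

theorem eq_zero_of_mem_freePiece_const {n j : ℕ} (hj : j < n) {x : ι →₀ R}
    (hx : x ∈ freePiece 𝒜 (fun _ => n) j) : x = 0 :=
  Finsupp.ext fun b => (mem_shiftPiece_of_lt hj).1 (hx b)

variable [GradedAlgebra 𝒜]

theorem map_mem_freePiece_of_linear (hφ : ∀ b c, φ (Finsupp.single b 1) c ∈ 𝒜 1) (n j : ℕ)
    {x : ι →₀ R} (hx : x ∈ freePiece 𝒜 (fun _ => n + 1) j) :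
    φ x ∈ freePiece 𝒜 (fun _ => n) j := by
  by_cases h : n + 1 ≤ j
  · obtain ⟨k, rfl⟩ := Nat.exists_eq_add_of_le h
    intro c
    rw [add_assoc, mem_shiftPiece_add, add_comm 1 k]
    exact map_coord_mem 𝒜 φ hφ (fun b => mem_shiftPiece_add.1 (hx b)) c
  · rw [eq_zero_of_mem_freePiece_const (not_le.1 h) hx, map_zero]
    exact Submodule.zero_mem _

theorem map_apply_mem_irrelevant_of_linear (hφ : ∀ b c, φ (Finsupp.single b 1) c ∈ 𝒜 1)
    (x : ι →₀ R) (c : κ) : φ x c ∈ (HomogeneousIdeal.irrelevant 𝒜).toIdeal := by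
  rw [map_eq_sum_single φ x, Finsupp.finsetSum_apply]
  exact Ideal.sum_mem _ fun b _ => Ideal.mul_mem_left _ _
    (HomogeneousIdeal.mem_irrelevant_of_mem 𝒜 one_pos (hφ b c))

end LinearMatrices

/-! ### Rees relations as polynomials vanishing at the generators -/

section Polynomials

variable {R : Type*} [CommRing R] {s : ℕ}

/-- Each of the `m` factors `f k T` contributes one `T`. Thus on forms of degree `m` the relations
are the kernel of evaluation at `f`, which links `L` to `I ^ m`. -/
theorem coe_reesMap_of_isHomogeneous (f : Fin s → R) {m : ℕ} {F : MvPolynomial (Fin s) R}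
    (hF : F.IsHomogeneous m) :
    (reesMap f F : R[X]) = Polynomial.monomial m (MvPolynomial.eval f F) := by
  have h1 : (reesMap f F : R[X]) =
      MvPolynomial.aeval (fun k => (Polynomial.monomial 1 (f k) : R[X])) F :=
    MvPolynomial.map_aeval _ (reesAlgebra (Ideal.span (Set.range f))).val.toRingHom F
  rw [h1, MvPolynomial.aeval_def, MvPolynomial.eval₂_eq, MvPolynomial.eval_eq, map_sum]
  refine Finset.sum_congr rfl fun α hα => ?_
  have hdeg : ∑ i ∈ α.support, α i = m := by
    have h := hF (MvPolynomial.mem_support_iff.1 hα)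
    rw [show (1 : Fin s → ℕ) = fun _ => 1 from rfl, ← Finsupp.degree_eq_weight_one] at h
    exact h
  simp only [mul_pow, Finset.prod_mul_distrib,
    Finset.prod_pow_eq_pow_sum, hdeg, ← Polynomial.C_mul_X_pow_eq_monomial, map_mul, map_prod,
    map_pow, Polynomial.algebraMap_eq]
  ring

theorem mem_reesRelations_iff_of_isHomogeneous (f : Fin s → R) {m : ℕ}
    {F : MvPolynomial (Fin s) R} (hF : F.IsHomogeneous m) :
    F ∈ reesRelations f ↔ MvPolynomial.eval f F = 0 := by
  rw [reesRelations, RingHom.mem_ker, ← Polynomial.monomial_eq_zero_iff (MvPolynomial.eval f F) m,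
    ← coe_reesMap_of_isHomogeneous f hF, ZeroMemClass.coe_eq_zero]

theorem isHomogeneous_of_coeff {m : ℕ} {F : MvPolynomial (Fin s) R}
    (h : ∀ α : Fin s →₀ ℕ, α.degree ≠ m → F.coeff α = 0) : F.IsHomogeneous m := by
  intro α hα
  rw [show (1 : Fin s → ℕ) = fun _ => 1 from rfl, ← Finsupp.degree_eq_weight_one]
  by_contra hne
  exact hα (h α hne)

theorem coeff_eq_zero_of_isHomogeneous {m : ℕ} {F : MvPolynomial (Fin s) R}
    (hF : F.IsHomogeneous m) {α : Fin s →₀ ℕ} (hα : α.degree ≠ m) : F.coeff α = 0 := by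
  by_contra hne
  have h := hF hne
  rw [show (1 : Fin s → ℕ) = fun _ => 1 from rfl, ← Finsupp.degree_eq_weight_one] at h
  exact hα h

variable {K : Type*} [Field K] [Algebra K R] {𝒜 : ℕ → Submodule K R} [GradedAlgebra 𝒜]

theorem eval_mem_of_mem_bidegPiece {d : ℕ} {f : Fin s → R} (hf : ∀ k, f k ∈ 𝒜 d) {a b : ℕ}
    {F : MvPolynomial (Fin s) R} (hF : F ∈ bidegPiece 𝒜 s d a b) :
    MvPolynomial.eval f F ∈ 𝒜 b := by
  rw [MvPolynomial.eval_eq]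
  refine Submodule.sum_mem _ fun α _ => ?_
  have hα := hF α
  by_cases hdeg : α.degree = a
  · rw [if_pos hdeg] at hα
    by_cases hle : a * d ≤ b
    · rw [mem_shiftPiece_of_le hle] at hα
      have hprod : ∏ i ∈ α.support, f i ^ α i ∈ 𝒜 (a * d) := by
        have h := SetLike.prod_mem_graded (A := 𝒜) (F := α.support)
          (i := fun i => α i * d) (g := fun i => f i ^ α i) (fun i _ => SetLike.pow_mem_graded (A := 𝒜) (α i) (hf i))
        rwa [← Finset.sum_mul, show ∑ i ∈ α.support, α i = a from hdeg] at h
      have h := SetLike.GradedMul.mul_mem hα hprod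
      rwa [Nat.sub_add_cancel hle] at h
    · rw [mem_shiftPiece_of_lt (not_le.1 hle)] at hα
      rw [hα, zero_mul]
      exact Submodule.zero_mem _
  · rw [if_neg hdeg, Submodule.mem_bot] at hα
    rw [hα, zero_mul]
    exact Submodule.zero_mem _

theorem isHomogeneous_pow_span {d : ℕ} {f : Fin s → R} (hf : ∀ k, f k ∈ 𝒜 d) (m : ℕ) :
    (Ideal.span (Set.range f) ^ m).IsHomogeneous 𝒜 := by
  have h : (Ideal.span (Set.range f)).IsHomogeneous 𝒜 := by
    refine Ideal.homogeneous_span 𝒜 _ ?_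
    rintro _ ⟨k, rfl⟩
    exact ⟨d, hf k⟩
  induction m with
  | zero =>
    rw [pow_zero, Ideal.one_eq_top]
    exact Ideal.IsHomogeneous.top 𝒜
  | succ m ih =>
    rw [pow_succ]
    exact ih.mul h

end Polynomials

/-! ### Counting monomials -/

section Count

/-- Truncated subtraction matters only for `s = k = 0`, where `choose 0 0 = 1` still counts the
empty monomial. -/
theorem encard_degree_eq (s k : ℕ) :
    {α : Fin s →₀ ℕ | α.degree = k}.encard = ((s + k - 1).choose k : ℕ) := by
  classical
  have e : Sym (Fin s) k ≃ {α : Fin s →₀ ℕ | α.degree = k} := Sym.equivNatSum (Fin s) k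
  rw [← ENat.card_coe_set_eq, ← ENat.card_congr e, ENat.card_eq_coe_fintype_card,
    Sym.card_sym_eq_choose, Fintype.card_fin]

end Count

/-! ### The part of `T`-degree `m` of the Koszul resolution -/

section KoszulStrand

variable {K : Type*} {R : Type*} [Field K] [CommRing R] [Algebra K R] {𝒜 : ℕ → Submodule K R}
  {s d : ℕ} {J : Ideal (MvPolynomial (Fin s) R)} {r : ℕ}

namespace KoszulResolution

/-- The coordinates of vectors over `R[T_1, …, T_s]` in the monomial basis over `R`. -/
def monomialRepr (R : Type*) [CommRing R] (s : ℕ) (ι : Type) :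
    (ι →₀ MvPolynomial (Fin s) R) ≃ₗ[R] ((Fin s →₀ ℕ) × ι →₀ R) :=
  ((MvPolynomial.basisMonomials (Fin s) R).smulTower Finsupp.basisSingleOne).repr

theorem monomialRepr_apply {ι : Type} (x : ι →₀ MvPolynomial (Fin s) R) (α : Fin s →₀ ℕ) (k : ι) :
    monomialRepr R s ι x (α, k) = (x k).coeff α :=
  Module.Basis.smulTower_repr_mk _ _ _ _ _

theorem coeff_monomialRepr_symm {ι : Type} (y : (Fin s →₀ ℕ) × ι →₀ R) (α : Fin s →₀ ℕ) (k : ι) :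
    ((monomialRepr R s ι).symm y k).coeff α = y (α, k) := by
  rw [← monomialRepr_apply, LinearEquiv.apply_symm_apply]

theorem monomialRepr_symm_single {ι : Type} (α : Fin s →₀ ℕ) (k : ι) :
    (monomialRepr R s ι).symm (Finsupp.single (α, k) 1) =
      MvPolynomial.monomial α (1 : R) • Finsupp.single k 1 := by
  rw [monomialRepr, Module.Basis.repr_symm_single_one, Module.Basis.smulTower_apply]
  simp

variable (C : KoszulResolution (bidegPiece 𝒜 s d 1 (d + 1)).toAddSubgroup J r)

/-- The differential of a Koszul resolution, in the monomial bases over `R`. -/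
def monomialD (i : ℕ) :
    ((Fin s →₀ ℕ) × C.ι (i + 1) →₀ R) →ₗ[R] ((Fin s →₀ ℕ) × C.ι i →₀ R) :=
  (monomialRepr R s (C.ι i)).toLinearMap ∘ₗ (C.d i).restrictScalars R ∘ₗ
    (monomialRepr R s (C.ι (i + 1))).symm.toLinearMap

theorem monomialD_apply (i : ℕ) (x : (Fin s →₀ ℕ) × C.ι (i + 1) →₀ R) :
    C.monomialD i x =
      monomialRepr R s (C.ι i) (C.d i ((monomialRepr R s (C.ι (i + 1))).symm x)) := rfl

theorem exact_monomialD (i : ℕ) : Function.Exact (C.monomialD (i + 1)) (C.monomialD i) := by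
  intro x
  rw [monomialD_apply, LinearEquiv.map_eq_zero_iff, C.exact i]
  constructor
  · rintro ⟨y, hy⟩
    refine ⟨monomialRepr R s _ y, ?_⟩
    rw [monomialD_apply, LinearEquiv.symm_apply_apply, hy, LinearEquiv.apply_symm_apply]
  · rintro ⟨y, rfl⟩
    exact ⟨(monomialRepr R s _).symm y, by rw [monomialD_apply, LinearEquiv.symm_apply_apply]⟩

theorem monomialD_single (i : ℕ) (b : (Fin s →₀ ℕ) × C.ι (i + 1)) (c : (Fin s →₀ ℕ) × C.ι i) :
    C.monomialD i (Finsupp.single b 1) c =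
      if b.1 ≤ c.1 then (C.d i (Finsupp.single b.2 1) c.2).coeff (c.1 - b.1) else 0 := by
  obtain ⟨α, k⟩ := b
  obtain ⟨β, l⟩ := c
  rw [monomialD_apply, monomialRepr_symm_single, monomialRepr_apply, map_smul,
    Finsupp.smul_apply, smul_eq_mul, MvPolynomial.coeff_monomial_mul', one_mul]

/-- The basis elements of total `T`-degree `m`. -/
def tdegreeSet (m i : ℕ) : Set ((Fin s →₀ ℕ) × C.ι i) := {p | p.1.degree + i = m}

theorem monomialD_single_mem (i : ℕ) (b c) : C.monomialD i (Finsupp.single b 1) c ∈ 𝒜 1 := by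
  rw [monomialD_single]
  split_ifs with hle
  · have h : (C.d i (Finsupp.single b.2 1) c.2).coeff (c.1 - b.1) ∈
        (if (c.1 - b.1).degree = 1 then shiftPiece 𝒜 (1 * d) (d + 1) else ⊥ : Submodule K R) :=
      C.d_single_mem i b.2 c.2 (c.1 - b.1)
    split_ifs at h with hdeg
    · rw [one_mul, mem_shiftPiece_add] at h
      exact h
    · rw [(Submodule.mem_bot K).1 h]
      exact Submodule.zero_mem _
  · exact Submodule.zero_mem _

/-- A nonzero matrix entry over `S` has `T`-degree one, so the drop of one in homological degree is
offset by a gain of one in monomial degree. -/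
theorem isBlockDiagonal_monomialD (m i : ℕ) :
    IsBlockDiagonal (C.tdegreeSet m (i + 1)) (C.tdegreeSet m i) (C.monomialD i) := by
  intro b c hne
  rw [monomialD_single] at hne
  split_ifs at hne with hle
  · have h : (C.d i (Finsupp.single b.2 1) c.2).coeff (c.1 - b.1) ∈
        (if (c.1 - b.1).degree = 1 then shiftPiece 𝒜 (1 * d) (d + 1) else ⊥ : Submodule K R) :=
      C.d_single_mem i b.2 c.2 (c.1 - b.1)
    split_ifs at h with hdeg
    · have hsum : c.1.degree = (c.1 - b.1).degree + b.1.degree := by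
        rw [← map_add, tsub_add_cancel_of_le hle]
      simp only [tdegreeSet, Set.mem_ofPred_eq]
      omega
    · exact absurd ((Submodule.mem_bot K).1 h) hne
  · exact absurd rfl hne

/-- The part of `T`-degree `m` of the differential. -/
def tdegreeD (m i : ℕ) : (C.tdegreeSet m (i + 1) →₀ R) →ₗ[R] (C.tdegreeSet m i →₀ R) :=
  block _ _ (C.monomialD i)

theorem tdegreeD_single_mem (m i : ℕ) (b c) : C.tdegreeD m i (Finsupp.single b 1) c ∈ 𝒜 1 := by
  simpa [tdegreeD, block] using C.monomialD_single_mem i b c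

/-- The homogeneous polynomial of degree `m` with given coefficients. -/
def toPolynomial (m : ℕ) : (C.tdegreeSet m 0 →₀ R) →ₗ[R] MvPolynomial (Fin s) R :=
  Finsupp.lapply C.base ∘ₗ (monomialRepr R s (C.ι 0)).symm.toLinearMap ∘ₗ
    extendZero R (C.tdegreeSet m 0)

theorem coeff_toPolynomial (m : ℕ) (x : C.tdegreeSet m 0 →₀ R) (α : Fin s →₀ ℕ) :
    (C.toPolynomial m x).coeff α = extendZero R (C.tdegreeSet m 0) x (α, C.base) :=
  coeff_monomialRepr_symm _ _ _

theorem toPolynomial_isHomogeneous (m : ℕ) (x : C.tdegreeSet m 0 →₀ R) :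
    (C.toPolynomial m x).IsHomogeneous m :=
  isHomogeneous_of_coeff fun α hα => by
    rw [coeff_toPolynomial]
    exact extendZero_apply_of_notMem _ _ hα

theorem toPolynomial_mem_bidegPiece {m j : ℕ} {x : C.tdegreeSet m 0 →₀ R}
    (hx : x ∈ freePiece 𝒜 (fun _ => m * d) j) : C.toPolynomial m x ∈ bidegPiece 𝒜 s d m j := by
  intro α
  rw [coeff_toPolynomial]
  split_ifs with hα
  · have h := hx ⟨(α, C.base), hα⟩
    rwa [← extendZero_apply] at h
  · exact extendZero_apply_of_notMem _ _ hα

theorem exists_toPolynomial_eq {m : ℕ} {F : MvPolynomial (Fin s) R} (hF : F.IsHomogeneous m) :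
    ∃ x, C.toPolynomial m x = F := by
  refine ⟨restrictTo R _ (monomialRepr R s (C.ι 0) (Finsupp.single C.base F)), ?_⟩
  ext α
  rw [coeff_toPolynomial, extendZero_restrictTo, monomialRepr_apply, Finsupp.single_eq_same]
  rintro ⟨β, k⟩ hβ
  rw [monomialRepr_apply, C.eq_base k, Finsupp.single_eq_same]
  exact coeff_eq_zero_of_isHomogeneous hF hβ

theorem toPolynomial_tdegreeD_mem (m : ℕ) (x) : C.toPolynomial m (C.tdegreeD m 0 x) ∈ J := by
  refine (C.mem_range_iff ((monomialRepr R s (C.ι 0)).symm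
    (extendZero R (C.tdegreeSet m 0) (C.tdegreeD m 0 x)))).1
    ⟨(monomialRepr R s _).symm (extendZero R (C.tdegreeSet m 1) x), ?_⟩
  rw [LinearEquiv.eq_symm_apply, tdegreeD, (C.isBlockDiagonal_monomialD m 0).extendZero_block, monomialD_apply]

theorem exists_tdegreeD_eq {m : ℕ} {x : C.tdegreeSet m 0 →₀ R} (hx : C.toPolynomial m x ∈ J) :
    ∃ y, C.tdegreeD m 0 y = x := by
  obtain ⟨y, hy⟩ := (C.mem_range_iff
    ((monomialRepr R s (C.ι 0)).symm (extendZero R (C.tdegreeSet m 0) x))).2 hx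
  refine ⟨restrictTo R _ (monomialRepr R s _ y), ?_⟩
  rw [tdegreeD, ← (C.isBlockDiagonal_monomialD m 0).restrictTo_map, monomialD_apply,
    LinearEquiv.symm_apply_apply, hy, LinearEquiv.apply_symm_apply, restrictTo_extendZero]

/-- The case split is needed: for `i > m` truncated subtraction would make the second binomial `1`,
although no basis element exists. -/
theorem encard_tdegreeSet (m i : ℕ) : (C.tdegreeSet m i).encard =
    ((if i ≤ m then r.choose i * (s + m - i - 1).choose (m - i) else 0 : ℕ) : ℕ∞) := by
  split_ifs with hi
  · have h : C.tdegreeSet m i = {α : Fin s →₀ ℕ | α.degree = m - i} ×ˢ Set.univ := by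
      ext p
      simp only [tdegreeSet, Set.mem_ofPred_eq, Set.mem_prod, Set.mem_univ, and_true]
      omega
    have := C.finite i
    rw [h, Set.encard_prod, encard_degree_eq, Set.encard_univ, ENat.card_eq_coe_natCard, C.card,
      Nat.add_sub_assoc hi, mul_comm, Nat.cast_mul]
  · have h : C.tdegreeSet m i = ∅ := by
      ext p
      simp only [tdegreeSet, Set.mem_ofPred_eq, Set.mem_empty_iff_false, iff_false]
      omega
    rw [h, Set.encard_empty, Nat.cast_zero]

variable {f : Fin s → R}

/-- The augmentation of the part of `T`-degree `m` to the `m`-th power of the ideal. -/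
def toPow (f : Fin s → R) (m : ℕ) :
    (C.tdegreeSet m 0 →₀ R) →ₗ[R] ↥(Ideal.span (Set.range f) ^ m) :=
  ((MvPolynomial.aeval f).toLinearMap ∘ₗ C.toPolynomial m).codRestrict _ fun x =>
    (Ideal.mem_span_pow_iff_exists_isHomogeneous f _).2
      ⟨C.toPolynomial m x, C.toPolynomial_isHomogeneous m x,
        (MvPolynomial.aeval_eq_eval f ▸ rfl :
          MvPolynomial.eval f (C.toPolynomial m x) = MvPolynomial.aeval f (C.toPolynomial m x))⟩

theorem coe_toPow (m : ℕ) (x : C.tdegreeSet m 0 →₀ R) :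
    (C.toPow f m x : R) = MvPolynomial.eval f (C.toPolynomial m x) := by
  rw [← MvPolynomial.coe_aeval_eq_eval]
  rfl

theorem toPow_eq_zero_iff (m : ℕ) (x : C.tdegreeSet m 0 →₀ R) :
    C.toPow f m x = 0 ↔ C.toPolynomial m x ∈ reesRelations f := by
  rw [mem_reesRelations_iff_of_isHomogeneous f (C.toPolynomial_isHomogeneous m x), ← coe_toPow,
    ZeroMemClass.coe_eq_zero]

theorem toPow_surjective (m : ℕ) : Function.Surjective (C.toPow f m) := by
  rintro ⟨u, hu⟩
  obtain ⟨F, hF, rfl⟩ := (Ideal.mem_span_pow_iff_exists_isHomogeneous f u).1 hu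
  obtain ⟨x, rfl⟩ := C.exists_toPolynomial_eq hF
  exact ⟨x, Subtype.ext (C.coe_toPow m x)⟩

variable [GradedAlgebra 𝒜]

theorem toPow_mem (hf : ∀ k, f k ∈ 𝒜 d) {m j : ℕ} {x : C.tdegreeSet m 0 →₀ R}
    (hx : x ∈ freePiece 𝒜 (fun _ => m * d) j) :
    C.toPow f m x ∈ idealPiece 𝒜 (Ideal.span (Set.range f) ^ m) j := by
  change (C.toPow f m x : R) ∈ 𝒜 j
  rw [coe_toPow]
  exact eval_mem_of_mem_bidegPiece hf (C.toPolynomial_mem_bidegPiece hx)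

/-- The part of `T`-degree `m` of a Koszul resolution of `R[T_1, …, T_s] / J`, as a partial
resolution of the `m`-th power of the ideal. -/
def partialResolution (hf : ∀ k, f k ∈ 𝒜 d) (m : ℕ) (hJ : J ≤ reesRelations f)
    (hL₁ : idealBidegPiece 𝒜 d (reesRelations f) m (m * d + 1) ≤ J.restrictScalars K)
    (hL₀ : idealBidegPiece 𝒜 d (reesRelations f) m (m * d) = ⊥) :
    PartialResolution 𝒜 (idealPiece 𝒜 (Ideal.span (Set.range f) ^ m)) (m * d) where
  ι i := C.tdegreeSet m i
  deg i _ := m * d + i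
  d := C.tdegreeD m
  ε := C.toPow f m
  d_deg i j _ hx := map_mem_freePiece_of_linear (C.tdegreeD_single_mem m i) (m * d + i) j hx
  ε_deg _ _ hx := C.toPow_mem hf hx
  ε_surjective := C.toPow_surjective m
  ε_d x := (C.toPow_eq_zero_iff m _).2 (hJ (C.toPolynomial_tdegreeD_mem m x))
  exact_zero j hj x hx hεx := by
    rw [toPow_eq_zero_iff] at hεx
    refine C.exists_tdegreeD_eq ?_
    have hmem : C.toPolynomial m x ∈ idealBidegPiece 𝒜 d (reesRelations f) m j :=
      ⟨hεx, C.toPolynomial_mem_bidegPiece hx⟩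
    -- Below degree `m * d` the free module vanishes, in degree `m * d` there are no relations, and
    -- in degree `m * d + 1` all relations lie in `J`.
    rcases lt_trichotomy j (m * d) with hlt | rfl | hgt
    · rw [eq_zero_of_mem_freePiece_const hlt hx, map_zero]
      exact J.zero_mem
    · rw [hL₀, Submodule.mem_bot] at hmem
      rw [hmem]
      exact J.zero_mem
    · obtain rfl : j = m * d + 1 := by omega
      exact hL₁ hmem
  exact_succ i := (C.isBlockDiagonal_monomialD m (i + 1)).exact (C.isBlockDiagonal_monomialD m i)
    (C.exact_monomialD i)
  minimal i := map_apply_mem_irrelevant_of_linear (C.tdegreeD_single_mem m i)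

theorem encard_strand_partialResolution (hf : ∀ k, f k ∈ 𝒜 d) (m : ℕ) (hJ hL₁ hL₀) (i : ℕ) :
    ((C.partialResolution (f := f) hf m hJ hL₁ hL₀).strand i).encard =
      ((if i ≤ m then r.choose i * (s + m - i - 1).choose (m - i) else 0 : ℕ) : ℕ∞) := by
  rw [← C.encard_tdegreeSet, ← ENat.card_coe_set_eq (C.tdegreeSet m i), ← Set.encard_univ]
  congr 1
  exact Set.eq_univ_of_forall fun b => rfl

end KoszulResolution

end KoszulStrand

/-! ### Powers of the ideal as graded modules -/

section Betti

variable {K : Type v} {R : Type u} [Field K] [CommRing R] [Algebra K R] (𝒜 : ℕ → Submodule K R)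
  [GradedAlgebra 𝒜] {s d : ℕ} {f : Fin s → R}

/-- The powers of an ideal generated by homogeneous elements, as graded modules. -/
def powGradedModule (hf : ∀ k, f k ∈ 𝒜 d) (m : ℕ) : BundledGradedModule 𝒜 :=
  letI : Decomposition (idealPiece 𝒜 (Ideal.span (Set.range f) ^ m)) :=
    (submodulePiece_isInternal 𝒜 (Ideal.span (Set.range f) ^ m) fun _ hx j =>
      isHomogeneous_pow_span hf m j hx).chooseDecomposition
  { carrier := ↥(Ideal.span (Set.range f) ^ m)
    piece := idealPiece 𝒜 (Ideal.span (Set.range f) ^ m)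
    smul_mem := fun _ _ _ ha _ hn => SetLike.GradedMul.mul_mem (A := 𝒜) ha hn }

/-- A power of an ideal generated in degree `d` vanishes in low degrees. -/
theorem idealPiece_pow_eq_bot (hf : ∀ k, f k ∈ 𝒜 d) (m j : ℕ) (hj : j < m * d) :
    idealPiece 𝒜 (Ideal.span (Set.range f) ^ m) j = ⊥ := by
  have : Decomposition (idealPiece 𝒜 (Ideal.span (Set.range f) ^ m)) :=
    (powGradedModule 𝒜 hf m).decomposition
  -- Only the augmentation is used: it presents the power as a graded quotient of a free module
  -- generated in degree `m * d`.
  let C := KoszulResolution.trivial (bidegPiece 𝒜 s d 1 (d + 1)).toAddSubgroup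
  rw [eq_bot_iff]
  intro u hu
  obtain ⟨x, rfl⟩ := C.toPow_surjective (f := f) m u
  have h := decompose_map_of_mem (freePiece 𝒜 fun _ => m * d)
    (idealPiece 𝒜 (Ideal.span (Set.range f) ^ m)) (C.toPow f m) (fun _ _ => C.toPow_mem hf) x j
  rw [decompose_of_mem_same _ hu,
    eq_zero_of_mem_freePiece_const hj (decompose (freePiece 𝒜 fun _ => m * d) x j).2,
    map_zero] at h
  exact h

end Betti

end ReesBetti

end

/-! ### The Betti number formula -/

theorem proposition3p3 {K : Type v} {R : Type u} [Field K] [CommRing R] [Algebra K R]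
    (𝒜 : ℕ → Submodule K R) [GradedAlgebra 𝒜]
    (h𝒜 : Function.Bijective (algebraMap K (𝒜 0)))
    (s d : ℕ) (f : Fin s → R) (hf : ∀ k, f k ∈ 𝒜 d)
    (hmin : ∀ k, f k ∉ Ideal.span (f '' {k}ᶜ))
    (I : Ideal R) (hI : I = Ideal.span (Set.range f))
    (r : ℕ) (g : Fin r → MvPolynomial (Fin s) R)
    (hreg : RingTheory.Sequence.IsRegular (MvPolynomial (Fin s) R) (List.ofFn g))
    (hspan : Submodule.span K (Set.range g) =
      ReesBetti.idealBidegPiece 𝒜 d (ReesBetti.reesRelations f) 1 (d + 1))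
    (m : ℕ) (hm : 1 ≤ m)
    (hL₁ : ReesBetti.idealBidegPiece 𝒜 d (ReesBetti.reesRelations f) m (m * d + 1) =
      ReesBetti.idealBidegPiece 𝒜 d (Ideal.span (Set.range g)) m (m * d + 1))
    (hL₀ : ReesBetti.idealBidegPiece 𝒜 d (ReesBetti.reesRelations f) m (m * d) = ⊥)
    (i : ℕ) :
    ReesBetti.HasGradedBetti 𝒜 (ReesBetti.idealPiece 𝒜 (I ^ m)) i (m * d + i)
      (if i ≤ m then r.choose i * (s + m - i - 1).choose (m - i) else 0) := by
  subst hI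
  have : Nontrivial R := by
    have : Nontrivial (𝒜 0) := h𝒜.injective.nontrivial
    exact Subtype.val_injective.nontrivial (f := ((↑) : 𝒜 0 → R))
  have hg : ∀ k, g k ∈ ReesBetti.idealBidegPiece 𝒜 d (ReesBetti.reesRelations f) 1 (d + 1) :=
    fun k => hspan ▸ Submodule.subset_span (Set.mem_range_self k)
  have hJ : Ideal.ofList (List.ofFn g) = Ideal.span (Set.range g) := by
    rw [Ideal.ofList]
    congr 1
    ext a
    exact List.mem_ofFn' g a
  obtain ⟨C⟩ := ReesBetti.nonempty_koszulResolution
    (ReesBetti.bidegPiece 𝒜 s d 1 (d + 1)).toAddSubgroup (List.ofFn g)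
    (fun a ha => by
      obtain ⟨k, rfl⟩ := (List.mem_ofFn' g a).1 ha
      exact (hg k).2) hreg.toIsWeaklyRegular
  rw [List.length_ofFn] at C
  refine ⟨ReesBetti.nonempty_minimalGradedFreeResolution h𝒜.surjective
    (ReesBetti.powGradedModule 𝒜 hf m), fun F => ?_⟩
  have : DirectSum.Decomposition (ReesBetti.idealPiece 𝒜 (Ideal.span (Set.range f) ^ m)) :=
    (ReesBetti.powGradedModule 𝒜 hf m).decomposition
  have hle : Ideal.ofList (List.ofFn g) ≤ ReesBetti.reesRelations f := by
    rw [hJ, Ideal.span_le]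
    rintro _ ⟨k, rfl⟩
    exact (hg k).1
  have hP := C.encard_strand_partialResolution hf m hle
    (by rw [hL₁, hJ]; exact inf_le_left) hL₀ i
  rw [← hP]
  -- The summands `R(-(m * d + i))` of `F` are by definition its strand in position `i`, which is
  -- compared with the Koszul strand.
  exact (F.toPartialResolution (m * d)).encard_strand_eq
    (ReesBetti.idealPiece_pow_eq_bot 𝒜 hf m) _ i
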